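/- **Theorem 1.4 (Dimension calculation).** Let $G$ be a finitely generated abelian group with $G\cong\mathbb Z^m\oplus\bigoplus_{i=1}^l\mathbb Z_{q_i}$, where $m,l\ge 0$ and $q_i\ge 1$ are integers. Let $S$ be a finite multiset of elements of $G$ (repetitions and $0\in S$ are allowed) that generates $G$ and is symmetric: $S=-S$, counted with multiplicity. Let $d^S(x,y)$ be the word metric of the Cayley graph $(G,S)$, i.e. the length of a shortest path $x=x_0\sim x_1\sim\dots\sim x_k=y$, where $x\sim y$ means $y-x\in S$, and for $u:G\to\mathbb R$ let $$L^Su(x)=\sum_{s\in S}\bigl(u(x+s)-u(x)\bigr),$$ the sum being taken with multiplicity. Fix $p\in G$ and a real number $d\ge 0$, and put $$H^d(G,S)=\{u:G\to\mathbb R \mid L^Su=0,\ \exists C\ \forall x\ |u(x)|\le C(d^S(p,x)+1)^d\},$$ $$HM^d(G,S)=\operatorname{Span}_{\mathbb R}\{u:G\to\mathbb R \mid L^Su=0,\ \exists C\ \forall x\ u(x)\ge -C(d^S(p,x)+1)^d\}.$$ Let $[d]$ be the largest integer not exceeding $d$, and let $HP^k(\mathbb R^m)$ be the space of real polynomials $f$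 in $m$ variables of degree at most $k$ with $\Delta f=\sum_{i=1}^m\partial_i^2f=0$. Then these spaces are finite-dimensional over $\mathbb R$, and $$\dim HM^d(G,S)=\dim H^d(G,S)=\dim HP^{[d]}(\mathbb R^m).$$ If $m\ge 1$, then with $k=[d]$ this common value is $$\binom{m+k-1}{k}+\binom{m+k-2}{k-1},$$ where the second term is read as $0$ when $k=0$. In particular, $\dim HM^d(G,S)$ and $\dim H^d(G,S)$ do not depend on the choice of the generating multiset $S$ (nor on $p$). -/

import Mathlib

namespace CayleyHarmonic

/-- A finite generating family of an abelian group, recorded as a multiset `S` (repetitions and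
`0 ∈ S` are allowed), which is symmetric, `S = -S` with multiplicities. -/
structure IsSymmGenerating {G : Type*} [AddCommGroup G] (S : Multiset G) : Prop where
  symm : S.map (fun s => -s) = S
  closure_eq_top : AddSubgroup.closure {s : G | s ∈ S} = ⊤

/-- Adjacency `x ∼ y` in the Cayley graph of `(G, S)`. -/
def Adj {G : Type*} [AddCommGroup G] (S : Multiset G) (x y : G) : Prop :=
  y - x ∈ S

/-- The word metric `d^S(x, y)`: the least length `k` of a path
`x = w 0 ∼ w 1 ∼ ⋯ ∼ w k = y` in the Cayley graph of `(G, S)`. -/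
noncomputable def wordDist {G : Type*} [AddCommGroup G] (S : Multiset G) (x y : G) : ℕ :=
  sInf {k : ℕ | ∃ w : ℕ → G, w 0 = x ∧ w k = y ∧ ∀ i < k, Adj S (w i) (w (i + 1))}

/-- The discrete Laplacian `L^S f (x) = ∑_{y ∼ x} (f y - f x)`, every neighbour being counted with
the multiplicity of the edge, that is, `∑_{s ∈ S} (f (x + s) - f x)`. -/
def laplacian {G : Type*} [AddCommGroup G] (S : Multiset G) : (G → ℝ) →ₗ[ℝ] (G → ℝ) where
  toFun f := fun x => (S.map fun s => f (x + s) - f x).sum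
  map_add' f g := by
    funext x
    simp only [Pi.add_apply, ← Multiset.sum_map_add]
    congr 1
    refine Multiset.map_congr rfl fun s _ => ?_
    ring
  map_smul' c f := by
    funext x
    simp only [Pi.smul_apply, smul_eq_mul, RingHom.id_apply, ← Multiset.sum_map_mul_left]
    congr 1
    refine Multiset.map_congr rfl fun s _ => ?_
    ring

/-- `H^d(G, S)`: the space of harmonic functions `u` with `|u x| ≤ C (d^S(p, x) + 1)^d` for some
constant `C`. -/
noncomputable def polyGrowth {G : Type*} [AddCommGroup G] (S : Multiset G) (p : G) (d : ℝ) :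
    Submodule ℝ (G → ℝ) where
  carrier := {u | laplacian S u = 0 ∧
    ∃ C : ℝ, ∀ x, |u x| ≤ C * ((wordDist S p x : ℝ) + 1) ^ d}
  zero_mem' := ⟨map_zero _, 0, fun x => by simp⟩
  add_mem' := by
    rintro u v ⟨hu, C, hC⟩ ⟨hv, D, hD⟩
    refine ⟨by rw [map_add, hu, hv, add_zero], C + D, fun x => ?_⟩
    rw [add_mul]
    exact (abs_add_le _ _).trans (add_le_add (hC x) (hD x))
  smul_mem' := by
    rintro c u ⟨hu, C, hC⟩
    refine ⟨by rw [map_smul, hu, smul_zero], |c| * C, fun x => ?_⟩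
    rw [Pi.smul_apply, smul_eq_mul, abs_mul, mul_assoc]
    exact mul_le_mul_of_nonneg_left (hC x) (abs_nonneg c)

/-- `HM^d(G, S)`: the linear span of the harmonic functions `u` with
`u x ≥ -C (d^S(p, x) + 1)^d` for some constant `C`. -/
noncomputable def oneSidedGrowth {G : Type*} [AddCommGroup G] (S : Multiset G) (p : G) (d : ℝ) :
    Submodule ℝ (G → ℝ) :=
  Submodule.span ℝ {u | laplacian S u = 0 ∧
    ∃ C : ℝ, ∀ x, u x ≥ -C * ((wordDist S p x : ℝ) + 1) ^ d}

/-- The Euclidean Laplacian `Δ = ∑ i, ∂² / ∂ x_i²` on real polynomials in `m` variables. -/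
noncomputable def polyLaplacian (m : ℕ) :
    MvPolynomial (Fin m) ℝ →ₗ[ℝ] MvPolynomial (Fin m) ℝ :=
  ∑ i, (MvPolynomial.pderiv i).toLinearMap ∘ₗ (MvPolynomial.pderiv i).toLinearMap

/-- `HP^k(ℝ^m)`: the harmonic polynomials on `ℝ^m` of degree at most `k`. -/
noncomputable def harmonicPoly (m k : ℕ) : Submodule ℝ (MvPolynomial (Fin m) ℝ) :=
  MvPolynomial.restrictTotalDegree (Fin m) ℝ k ⊓ LinearMap.ker (polyLaplacian m)

end CayleyHarmonic

/-! Let `P` be the averaging operator of the random walk with steps `S`, so that harmonic means `P u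
= u`. The theorem splits into a Liouville theorem (a harmonic function with a one-sided bound of
order `d` is a polynomial in the free coordinates of degree at most `[d]`) and a dimension count for
a constant-coefficient operator on polynomials.

Liouville theorem. On an abelian group differences of harmonic functions are harmonic, and `P (u²) =
u² + Γ u`, where `Γ u` averages the squared differences of `u` along the steps. Iterating with
Pascal's rule gives `choose N k * Γ_k u ≤ P^N (u²)` (`choose_mul_carreDuChamp_le`). If `|u|` has
polynomial growth of order `D`, the right side is `O(N^(2D))`; hence `Γ_k u = 0` for `k = 2D + 1`,
and all `k`-fold differences vanish. A one-sided bound `u ≥ -g` first becomes a crude two-sided one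
(`exists_abs_le_of_one_sided`): `|u| ≤ u + 2g` bounds `P^n |u|` at `p`, and after about `|y|²` steps
the walk sits at `y` with only polynomially small probability. The sharp degree comes from moments
at time `t²` (`mem_polyFun_of_mem_succ`): if the degree is exactly `n > d`, the second moment of `u`
is at least of order `t^(2n)`, the fourth at most `t^(4n)`, and the first absolute moment at most
`t^d`, which is impossible for large `t`.

Dimension count. Polynomial functions ignore torsion, so they are the polynomials in the free
coordinates (`map_evalLattice`). On these the Laplacian is, by Taylor expansion and symmetry of `S`,
a second-order operator with nonzero pure second derivatives plus terms lowering the degree by at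
least three. Such an operator maps degree `< n + 2` onto degree `< n`, so rank-nullity gives a
kernel dimension depending only on `m` and the degree, the same as for the Euclidean Laplacian. -/

namespace CayleyHarmonic

/-! ### Polynomial functions on an abelian group. -/

section Differences

variable {G : Type*} [AddCommGroup G]

/-- The difference operator `u ↦ u (· + g) - u`. -/
def diff (g : G) : (G → ℝ) →ₗ[ℝ] (G → ℝ) where
  toFun u := fun x => u (x + g) - u x
  map_add' u v := by
    funext x
    simp only [Pi.add_apply]
    ring
  map_smul' c u := by
    funext x
    simp only [Pi.smul_apply, smul_eq_mul, RingHom.id_apply]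
    ring

@[simp]
theorem diff_apply (g : G) (u : G → ℝ) (x : G) : diff g u x = u (x + g) - u x := rfl

/-- Functions on `G` all of whose `n`-fold differences vanish: polynomial functions of degree
less than `n`. -/
def polyFun (G : Type*) [AddCommGroup G] : ℕ → Submodule ℝ (G → ℝ)
  | 0 => ⊥
  | n + 1 => ⨅ g : G, (polyFun G n).comap (diff g)

theorem mem_polyFun_zero {u : G → ℝ} : u ∈ polyFun G 0 ↔ u = 0 := Submodule.mem_bot ℝ

theorem mem_polyFun_succ {n : ℕ} {u : G → ℝ} :
    u ∈ polyFun G (n + 1) ↔ ∀ g, diff g u ∈ polyFun G n := by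
  simp [polyFun, Submodule.mem_iInf]

theorem mem_polyFun_one {u : G → ℝ} : u ∈ polyFun G 1 ↔ ∀ x, u x = u 0 := by
  rw [mem_polyFun_succ]
  simp only [mem_polyFun_zero]
  constructor
  · intro h x
    have := congrFun (h x) 0
    simp at this
    linarith
  · intro h g
    funext x
    simp [h (x + g), h x]

theorem polyFun_le_succ (n : ℕ) : polyFun G n ≤ polyFun G (n + 1) := by
  induction n with
  | zero => intro u hu; rw [mem_polyFun_zero.1 hu]; exact Submodule.zero_mem _
  | succ n ih =>
    intro u hu
    rw [mem_polyFun_succ] at hu ⊢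
    exact fun g => ih (hu g)

theorem polyFun_mono : Monotone (polyFun G) := monotone_nat_of_le_succ polyFun_le_succ

theorem diff_mem_polyFun {n : ℕ} {u : G → ℝ} (hu : u ∈ polyFun G n) (g : G) :
    diff g u ∈ polyFun G (n - 1) := by
  cases n with
  | zero => rw [mem_polyFun_zero.1 hu, map_zero]; exact Submodule.zero_mem _
  | succ n => exact mem_polyFun_succ.1 hu g

theorem const_mem_polyFun (c : ℝ) (n : ℕ) : (fun _ : G => c) ∈ polyFun G (n + 1) :=
  polyFun_mono (Nat.le_add_left 1 n) (mem_polyFun_one.2 fun _ => rfl)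

theorem translate_mem_polyFun {n : ℕ} {u : G → ℝ} (hu : u ∈ polyFun G n) (g : G) :
    (fun x => u (x + g)) ∈ polyFun G n := by
  have : (fun x => u (x + g)) = u + diff g u := by funext x; simp
  rw [this]
  exact add_mem hu (polyFun_mono (Nat.sub_le n 1) (diff_mem_polyFun hu g))

/-- The directions in which the difference of `u` has degree less than `n`. -/
def diffStabilizer (u : G → ℝ) (n : ℕ) : AddSubgroup G where
  carrier := {g | diff g u ∈ polyFun G n}
  zero_mem' := by
    have : diff (0 : G) u = 0 := by funext x; simp
    simp [this]
  add_mem' := by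
    intro g h hg hh
    have : diff (g + h) u = diff g u + fun x => diff h u (x + g) := by
      funext x
      simp [add_assoc]
    simp only [Set.mem_ofPred_eq, this]
    exact add_mem hg (translate_mem_polyFun hh g)
  neg_mem' := by
    intro g hg
    have : diff (-g) u = -fun x => diff g u (x + -g) := by
      funext x
      simp
    simp only [Set.mem_ofPred_eq, this]
    exact neg_mem (translate_mem_polyFun hg _)

/-- Since `diffStabilizer u n` is a subgroup, the differences need testing only along generators. -/
theorem mem_polyFun_succ_of_closure {A : Set G} (hA : AddSubgroup.closure A = ⊤) {n : ℕ}
    {u : G → ℝ} (h : ∀ g ∈ A, diff g u ∈ polyFun G n) : u ∈ polyFun G (n + 1) := by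
  have : AddSubgroup.closure A ≤ diffStabilizer u n := (AddSubgroup.closure_le _).2 h
  rw [hA] at this
  exact mem_polyFun_succ.2 fun g => this (AddSubgroup.mem_top g)

/-- The discrete Leibniz rule has an extra term, the product of both differences, of still lower
degree; induction is on the total degree. -/
theorem mul_mem_polyFun {a b : ℕ} {u v : G → ℝ} (hu : u ∈ polyFun G (a + 1))
    (hv : v ∈ polyFun G (b + 1)) : u * v ∈ polyFun G (a + b + 1) := by
  have zero_case : ∀ {w z : G → ℝ} {n k : ℕ}, w ∈ polyFun G 1 → z ∈ polyFun G n → n ≤ k →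
      w * z ∈ polyFun G k := by
    intro w z n k hw hz hk
    have : w * z = w 0 • z := by
      funext x
      simp [mem_polyFun_one.1 hw x]
    rw [this]
    exact Submodule.smul_mem _ _ (polyFun_mono hk hz)
  induction hn : a + b generalizing a b u v with
  | zero =>
    obtain ⟨rfl, rfl⟩ : a = 0 ∧ b = 0 := by omega
    exact zero_case hu hv le_rfl
  | succ n ih =>
    rcases Nat.eq_zero_or_pos a with rfl | ha
    · exact zero_case hu hv (by omega)
    rcases Nat.eq_zero_or_pos b with rfl | hb
    · rw [mul_comm]
      exact zero_case hv hu (by omega)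
    obtain ⟨a, rfl⟩ := Nat.exists_eq_add_of_le' ha
    obtain ⟨b, rfl⟩ := Nat.exists_eq_add_of_le' hb
    rw [mem_polyFun_succ]
    intro g
    have hdu := mem_polyFun_succ.1 hu g
    have hdv := mem_polyFun_succ.1 hv g
    have key : diff g (u * v) = diff g u * v + u * diff g v + diff g u * diff g v := by
      funext x
      simp only [diff_apply, Pi.mul_apply, Pi.add_apply]
      ring
    rw [key]
    refine add_mem (add_mem ?_ ?_) ?_
    · exact ih hdu hv (by omega)
    · exact ih hu hdv (by omega)
    · exact ih hdu (polyFun_le_succ _ hdv) (by omega)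

theorem pow_mem_polyFun {a : ℕ} {u : G → ℝ} (hu : u ∈ polyFun G (a + 1)) (n : ℕ) :
    u ^ n ∈ polyFun G (n * a + 1) := by
  induction n with
  | zero => simpa using (mem_polyFun_one.2 fun _ => rfl : (1 : G → ℝ) ∈ polyFun G 1)
  | succ n ih =>
    rw [pow_succ, add_mul, one_mul]
    exact mul_mem_polyFun ih hu

/-- Polynomial functions are invariant under torsion elements. -/
theorem diff_eq_zero_of_isOfFinAddOrder {t : G} (ht : IsOfFinAddOrder t) {n : ℕ} {u : G → ℝ}
    (hu : u ∈ polyFun G n) : diff t u = 0 := by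
  induction n generalizing u with
  | zero => rw [mem_polyFun_zero.1 hu, map_zero]
  | succ n ih =>
    -- Vanishing second difference makes `u` affine along the multiples of `t`; these are periodic,
    -- so the slope is zero.
    have h2 : diff t (diff t u) = 0 := ih (mem_polyFun_succ.1 hu t)
    funext x
    have h3 : ∀ k : ℕ, u (x + k • t) = u x + k * diff t u x := by
      intro k
      induction k with
      | zero => simp
      | succ k ihk =>
        have h4 : ∀ k : ℕ, diff t u (x + k • t) = diff t u x := by
          intro k
          induction k with
          | zero => simp
          | succ k ihk =>
            have := congrFun h2 (x + k • t)
            rw [diff_apply, Pi.zero_apply, sub_eq_zero] at this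
            rw [succ_nsmul, ← add_assoc, this, ihk]
        have h5 := h4 k
        rw [diff_apply, add_assoc, ← succ_nsmul, ihk] at h5
        push_cast
        linarith
    have h4 := h3 (addOrderOf t)
    rw [addOrderOf_nsmul_eq_zero, add_zero] at h4
    have h5 : (0 : ℝ) < addOrderOf t := by exact_mod_cast ht.addOrderOf_pos
    have h6 : (addOrderOf t : ℝ) * diff t u x = 0 := by linarith
    exact (mul_eq_zero.1 h6).resolve_left h5.ne'

end Differences

end CayleyHarmonic

namespace CayleyHarmonic

/-! ### The random walk operator and the iterated carré du champ. -/

section Averaging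

variable {G : Type*} [AddCommGroup G] {ι : Type*} [Fintype ι]

/-- The transition operator of the random walk whose steps are the `s i`, all equally likely. -/
noncomputable def avg (s : ι → G) : (G → ℝ) →ₗ[ℝ] (G → ℝ) where
  toFun f := fun x => (∑ i, f (x + s i)) / Fintype.card ι
  map_add' u v := by
    funext x
    simp only [Pi.add_apply, Finset.sum_add_distrib, add_div]
  map_smul' c u := by
    funext x
    simp only [Pi.smul_apply, smul_eq_mul, RingHom.id_apply, ← Finset.mul_sum, mul_div_assoc]

theorem avg_apply (s : ι → G) (f : G → ℝ) (x : G) :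
    avg s f x = (∑ i, f (x + s i)) / Fintype.card ι := rfl

theorem avg_mono (s : ι → G) {f g : G → ℝ} (h : f ≤ g) : avg s f ≤ avg s g := fun _ =>
  div_le_div_of_nonneg_right (Finset.sum_le_sum fun _ _ => h _) (Nat.cast_nonneg _)

theorem avg_pow_succ_apply (s : ι → G) (N : ℕ) (f : G → ℝ) :
    (avg s ^ (N + 1)) f = (avg s ^ N) (avg s f) := by
  rw [pow_succ, Module.End.mul_apply]

theorem avg_pow_mono (s : ι → G) (N : ℕ) {f g : G → ℝ} (h : f ≤ g) :
    (avg s ^ N) f ≤ (avg s ^ N) g := by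
  induction N generalizing f g with
  | zero => simpa using h
  | succ N ih =>
    rw [avg_pow_succ_apply, avg_pow_succ_apply]
    exact ih (avg_mono s h)

theorem avg_pow_nonneg (s : ι → G) (N : ℕ) {f : G → ℝ} (h : 0 ≤ f) : 0 ≤ (avg s ^ N) f := by
  simpa using avg_pow_mono s N h

theorem avg_pow_eq_self (s : ι → G) (N : ℕ) {u : G → ℝ} (h : avg s u = u) :
    (avg s ^ N) u = u := by
  induction N with
  | zero => simp
  | succ N ih => rw [avg_pow_succ_apply, h, ih]

theorem avg_diff (s : ι → G) (g : G) (u : G → ℝ) : avg s (diff g u) = diff g (avg s u) := by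
  funext x
  simp only [avg_apply, diff_apply, ← sub_div, ← Finset.sum_sub_distrib, add_right_comm]

theorem avg_const [Nonempty ι] (s : ι → G) (c : ℝ) : avg s (fun _ => c) = fun _ => c := by
  funext x
  have : (Fintype.card ι : ℝ) ≠ 0 := Nat.cast_ne_zero.2 Fintype.card_ne_zero
  simp [avg_apply]

theorem avg_pow_const [Nonempty ι] (s : ι → G) (c : ℝ) (N : ℕ) :
    (avg s ^ N) (fun _ => c) = fun _ => c :=
  avg_pow_eq_self s N (avg_const s c)

/-- The iterated carré du champ: `carreDuChamp s k u x` is the average of the squares of the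
`k`-fold differences of `u` at `x` along the steps `s i`. -/
noncomputable def carreDuChamp (s : ι → G) : ℕ → (G → ℝ) → G → ℝ
  | 0, u => u ^ 2
  | k + 1, u => fun x => (∑ i, carreDuChamp s k (diff (s i) u) x) / Fintype.card ι

theorem carreDuChamp_succ (s : ι → G) (k : ℕ) (u : G → ℝ) :
    carreDuChamp s (k + 1) u =
      (Fintype.card ι : ℝ)⁻¹ • ∑ i, carreDuChamp s k (diff (s i) u) := by
  funext x
  simp only [carreDuChamp, Pi.smul_apply, Finset.sum_apply, smul_eq_mul]
  ring

theorem carreDuChamp_nonneg (s : ι → G) (k : ℕ) (u : G → ℝ) : 0 ≤ carreDuChamp s k u := by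
  induction k generalizing u with
  | zero => exact fun x => sq_nonneg (u x)
  | succ k ih =>
    exact fun x => div_nonneg (Finset.sum_nonneg fun i _ => ih _ x) (Nat.cast_nonneg _)

/-- Expanding the squared differences, harmonicity evaluates the cross term. -/
theorem avg_sq [Nonempty ι] (s : ι → G) {u : G → ℝ} (hu : avg s u = u) :
    avg s (u ^ 2) = u ^ 2 + carreDuChamp s 1 u := by
  funext x
  have hc : (Fintype.card ι : ℝ) ≠ 0 := Nat.cast_ne_zero.2 Fintype.card_ne_zero
  have h := congrFun hu x
  rw [avg_apply, div_eq_iff hc] at h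
  simp only [carreDuChamp, avg_apply, Pi.add_apply, Pi.pow_apply, diff_apply, sub_sq,
    Finset.sum_add_distrib, Finset.sum_sub_distrib, ← Finset.sum_mul, ← Finset.mul_sum, h,
    Finset.sum_const, Finset.card_univ, nsmul_eq_mul]
  field_simp
  ring

/-- One application of `avg_sq` splits `P^(N+1) (u²)` into `P^N (u²)` and the average of `P^N` of
the squared differences of `u`. These differences are again harmonic, so induction and Pascal's rule
add up the coefficients. -/
theorem choose_mul_carreDuChamp_le [Nonempty ι] (s : ι → G) (N k : ℕ) {u : G → ℝ}
    (hu : avg s u = u) (x : G) :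
    (N.choose k : ℝ) * carreDuChamp s k u x ≤ (avg s ^ N) (u ^ 2) x := by
  induction N generalizing k u with
  | zero =>
    cases k with
    | zero => simp [carreDuChamp]
    | succ k => simpa using sq_nonneg (u x)
  | succ N ih =>
    rw [avg_pow_succ_apply, avg_sq s hu, map_add, Pi.add_apply]
    cases k with
    | zero =>
      have h1 := ih 0 hu
      have h2 := avg_pow_nonneg s N (carreDuChamp_nonneg s 1 u) x
      simp only [Nat.choose_zero_right, Pi.zero_apply] at h1 h2 ⊢
      linarith
    | succ k =>
      have h1 := ih (k + 1) hu
      have h2 : (N.choose k : ℝ) * carreDuChamp s (k + 1) u x ≤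
          (avg s ^ N) (carreDuChamp s 1 u) x := by
        rw [carreDuChamp_succ s 0, carreDuChamp_succ s k, map_smul, map_sum, Pi.smul_apply,
          Pi.smul_apply, smul_eq_mul, smul_eq_mul, mul_left_comm, Finset.sum_apply,
          Finset.sum_apply, Finset.mul_sum]
        refine mul_le_mul_of_nonneg_left (Finset.sum_le_sum fun i _ => ?_)
          (inv_nonneg.2 (Nat.cast_nonneg _))
        exact ih k (by rw [avg_diff, hu])
      rw [Nat.choose_succ_succ]
      push_cast
      linarith

theorem mem_polyFun_of_carreDuChamp_eq_zero [Nonempty ι] {s : ι → G}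
    (hs : AddSubgroup.closure (Set.range s) = ⊤) {k : ℕ} {u : G → ℝ}
    (h : carreDuChamp s k u = 0) : u ∈ polyFun G k := by
  induction k generalizing u with
  | zero =>
    rw [mem_polyFun_zero]
    funext x
    simpa [carreDuChamp] using congrFun h x
  | succ k ih =>
    refine mem_polyFun_succ_of_closure hs ?_
    rintro _ ⟨i, rfl⟩
    apply ih
    funext x
    have hc : (Fintype.card ι : ℝ) ≠ 0 := Nat.cast_ne_zero.2 Fintype.card_ne_zero
    have h1 := congrFun h x
    rw [carreDuChamp, Pi.zero_apply, div_eq_zero_iff, or_iff_left hc,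
      Finset.sum_eq_zero_iff_of_nonneg fun i _ => carreDuChamp_nonneg s k _ x] at h1
    exact h1 i (Finset.mem_univ i)

/-- For degree at most `k` the `k`-fold differences are constants. -/
theorem carreDuChamp_eq_of_mem_polyFun (s : ι → G) {k : ℕ} {u : G → ℝ}
    (hu : u ∈ polyFun G (k + 1)) (x : G) : carreDuChamp s k u x = carreDuChamp s k u 0 := by
  induction k generalizing u with
  | zero => simp [carreDuChamp, mem_polyFun_one.1 hu x]
  | succ k ih =>
    simp only [carreDuChamp]
    congr 1
    exact Finset.sum_congr rfl fun i _ => ih (mem_polyFun_succ.1 hu (s i))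

/-- By symmetry of the steps, `P - 1` is a combination of the second differences `diff (-s i) ∘ diff
(s i)`, so it lowers the degree by two. -/
theorem avg_sub_mem_polyFun [Nonempty ι] {s : ι → G}
    (hs : ∀ f : G → ℝ, ∑ i, f (s i) = ∑ i, f (-s i)) {n : ℕ} {u : G → ℝ}
    (hu : u ∈ polyFun G (n + 2)) : avg s u - u ∈ polyFun G n := by
  have hc : (Fintype.card ι : ℝ) ≠ 0 := Nat.cast_ne_zero.2 Fintype.card_ne_zero
  have key : avg s u - u =
      (-(2 * Fintype.card ι : ℝ)⁻¹) • ∑ i, diff (-s i) (diff (s i) u) := by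
    funext x
    have h := hs fun g => u (x + g)
    simp only [Pi.sub_apply, avg_apply, Pi.smul_apply, Finset.sum_apply, diff_apply,
      Finset.sum_sub_distrib, neg_add_cancel_right, ← h, Finset.sum_const, Finset.card_univ,
      nsmul_eq_mul, smul_eq_mul]
    field_simp
    ring
  rw [key]
  refine Submodule.smul_mem _ _ (Submodule.sum_mem _ fun i _ => ?_)
  exact mem_polyFun_succ.1 (mem_polyFun_succ.1 hu _) _

/-- Telescoping `P^(N+1) v - P^N v = P^N (P v - v)` costs one power of `N` for every two degrees:
the diffusive scaling of the walk. -/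
theorem avg_pow_le_of_mem_polyFun [Nonempty ι] {s : ι → G}
    (hs : ∀ f : G → ℝ, ∑ i, f (s i) = ∑ i, f (-s i)) (p : G) {n : ℕ} {v : G → ℝ}
    (hv : v ∈ polyFun G (2 * n + 1)) :
    ∃ C : ℝ, 0 ≤ C ∧ ∀ N : ℕ, |(avg s ^ N) v p| ≤ C * ((N : ℝ) + 1) ^ n := by
  induction n generalizing v with
  | zero =>
    refine ⟨|v 0|, abs_nonneg _, fun N => ?_⟩
    have : v = fun _ => v 0 := funext (mem_polyFun_one.1 hv)
    rw [this, avg_pow_const]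
    simp
  | succ n ih =>
    obtain ⟨C, hC0, hC⟩ := ih (avg_sub_mem_polyFun hs hv)
    refine ⟨|v p| + C, by positivity, fun N => ?_⟩
    have h : |(avg s ^ N) v p| ≤ |v p| + N * (C * ((N : ℝ) + 1) ^ n) := by
      induction N with
      | zero => simp
      | succ N ihN =>
        have h1 : (avg s ^ (N + 1)) v p = (avg s ^ N) v p + (avg s ^ N) (avg s v - v) p := by
          rw [avg_pow_succ_apply, map_sub, Pi.sub_apply]
          ring
        have h2 : (((N : ℝ)) + 1) ^ n ≤ (((N + 1 : ℕ) : ℝ) + 1) ^ n := by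
          gcongr
          simp
        have h3 := mul_le_mul_of_nonneg_left h2 hC0
        have h4 := mul_le_mul_of_nonneg_left h3 (Nat.cast_nonneg (α := ℝ) N)
        rw [h1]
        refine (abs_add_le _ _).trans ?_
        have h5 := hC N
        push_cast at h3 h4 ⊢
        linarith
    have h1 : (1 : ℝ) ≤ ((N : ℝ) + 1) ^ (n + 1) :=
      one_le_pow₀ (by linarith [Nat.cast_nonneg (α := ℝ) N])
    have h2 : (N : ℝ) * (C * ((N : ℝ) + 1) ^ n) ≤ C * ((N : ℝ) + 1) ^ (n + 1) := by
      have : 0 ≤ C * ((N : ℝ) + 1) ^ n := by positivity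
      rw [pow_succ]
      nlinarith
    have h3 := mul_le_mul_of_nonneg_left h1 (abs_nonneg (v p))
    rw [add_mul]
    linarith

end Averaging

end CayleyHarmonic

namespace CayleyHarmonic

/-! ### Paths, the word metric and growth of functions. -/

section WordMetric

variable {G : Type*} [AddCommGroup G] {S : Multiset G} {ι : Type*} [Fintype ι] {s : ι → G}

/-- There is a path of length `k` from `x` to `y` in the Cayley graph. -/
def HasPath (S : Multiset G) (k : ℕ) (x y : G) : Prop :=
  ∃ w : ℕ → G, w 0 = x ∧ w k = y ∧ ∀ i < k, Adj S (w i) (w (i + 1))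

theorem hasPath_zero {x y : G} : HasPath S 0 x y ↔ x = y := by
  constructor
  · rintro ⟨w, h0, h1, -⟩
    exact h0.symm.trans h1
  · rintro rfl
    exact ⟨fun _ => x, rfl, rfl, by simp⟩

theorem hasPath_succ {k : ℕ} {x y : G} :
    HasPath S (k + 1) x y ↔ ∃ z, HasPath S k x z ∧ Adj S z y := by
  constructor
  · rintro ⟨w, h0, h1, h⟩
    refine ⟨w k, ⟨w, h0, rfl, fun i hi => h i (by omega)⟩, ?_⟩
    rw [← h1]
    exact h k (by omega)
  · rintro ⟨z, ⟨w, h0, h1, h⟩, hz⟩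
    refine ⟨fun i => if i ≤ k then w i else y, by simpa using h0, by simp, fun i hi => ?_⟩
    rcases Nat.lt_succ_iff_lt_or_eq.1 hi with hi' | rfl
    · have h2 : i + 1 ≤ k := hi'
      simpa [hi'.le, h2] using h i hi'
    · simpa [h1] using hz

theorem wordDist_le {k : ℕ} {x y : G} (h : HasPath S k x y) : wordDist S x y ≤ k :=
  Nat.sInf_le h

/-- By commutativity only the number of uses of each step matters, not their order. -/
theorem hasPath_iff (hS : S = Finset.univ.val.map s) {n : ℕ} {x y : G} :
    HasPath S n x y ↔ ∃ a : ι → ℕ, ∑ i, a i = n ∧ x + ∑ i, a i • s i = y := by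
  classical
  have hmem : ∀ g, g ∈ S ↔ ∃ i, s i = g := fun g => by simp [hS]
  induction n generalizing y with
  | zero =>
    rw [hasPath_zero]
    constructor
    · rintro rfl
      exact ⟨0, by simp, by simp⟩
    · rintro ⟨a, ha, rfl⟩
      have : ∀ i, a i = 0 := by simpa using ha
      simp [this]
  | succ n ih =>
    rw [hasPath_succ]
    constructor
    · rintro ⟨z, hz, hzy⟩
      obtain ⟨a, ha, rfl⟩ := ih.1 hz
      obtain ⟨j, hj⟩ := (hmem _).1 hzy
      refine ⟨a + Pi.single j 1, ?_, ?_⟩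
      · simp [Finset.sum_add_distrib, ha]
      · have h1 : ∑ i, (a + Pi.single j 1 : ι → ℕ) i • s i = ∑ i, a i • s i + s j := by
          simp only [Pi.add_apply, add_smul, Finset.sum_add_distrib]
          congr 1
          rw [Finset.sum_eq_single j (fun i _ hi => by simp [hi]) (by simp)]
          simp
        rw [h1, hj]
        abel
    · rintro ⟨a, ha, rfl⟩
      obtain ⟨j, hj⟩ : ∃ j, a j ≠ 0 := by
        by_contra! h
        simp [h] at ha
      have ha' : a = (a - Pi.single j 1) + Pi.single j 1 := by
        funext i
        rcases eq_or_ne i j with rfl | hi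
        · simp
          omega
        · simp [hi]
      set b := a - Pi.single j 1
      refine ⟨x + ∑ i, b i • s i, ih.2 ⟨b, ?_, rfl⟩, ?_⟩
      · rw [ha'] at ha
        simpa [Finset.sum_add_distrib] using ha
      · have h1 : ∑ i, a i • s i = ∑ i, b i • s i + s j := by
          rw [ha']
          simp only [Pi.add_apply, add_smul, Finset.sum_add_distrib]
          congr 1
          rw [Finset.sum_eq_single j (fun i _ hi => by simp [hi]) (by simp)]
          simp
        rw [Adj, hmem, h1]
        exact ⟨j, by abel⟩

theorem sum_comp_neg (hS : S = Finset.univ.val.map s) (hgen : IsSymmGenerating S)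
    {M : Type*} [AddCommMonoid M] (f : G → M) : ∑ i, f (s i) = ∑ i, f (-s i) := by
  have h1 : ∑ i, f (s i) = (S.map f).sum := by
    rw [hS, Multiset.map_map]
    rfl
  have h2 : ∑ i, f (-s i) = ((S.map fun g => -g).map f).sum := by
    rw [hS, Multiset.map_map, Multiset.map_map]
    rfl
  rw [h1, h2, hgen.symm]

theorem closure_range (hS : S = Finset.univ.val.map s) (hgen : IsSymmGenerating S) :
    AddSubgroup.closure (Set.range s) = ⊤ := by
  rw [← hgen.closure_eq_top]
  congr 1
  ext g
  simp [hS]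

theorem neg_mem_of_mem (hgen : IsSymmGenerating S) {g : G} (h : g ∈ S) : -g ∈ S := by
  rw [← hgen.symm]
  exact Multiset.mem_map_of_mem _ h

theorem exists_hasPath (hgen : IsSymmGenerating S) (x y : G) : ∃ k, HasPath S k x y := by
  have h : ∀ g : G, ∀ x, (∃ k, HasPath S k x (x + g)) := by
    intro g
    have hg : g ∈ AddSubmonoid.closure ({s : G | s ∈ S} ∪ -{s : G | s ∈ S}) := by
      rw [← AddSubgroup.closure_toAddSubmonoid, hgen.closure_eq_top]
      trivial
    induction hg using AddSubmonoid.closure_induction_right with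
    | zero => exact fun x => ⟨0, hasPath_zero.2 (add_zero x).symm⟩
    | add_right a _ b hb ih =>
      intro x
      obtain ⟨k, hk⟩ := ih x
      refine ⟨k + 1, hasPath_succ.2 ⟨_, hk, ?_⟩⟩
      have : b ∈ S := by
        rcases hb with hb | hb
        · exact hb
        · simpa using neg_mem_of_mem hgen hb
      rw [Adj]
      convert this using 1
      abel
  obtain ⟨k, hk⟩ := h (y - x) x
  exact ⟨k, by simpa using hk⟩

theorem hasPath_wordDist (hgen : IsSymmGenerating S) (x y : G) :
    HasPath S (wordDist S x y) x y :=
  Nat.sInf_mem (s := {k | HasPath S k x y}) (exists_hasPath hgen x y)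

theorem wordDist_add_le (hgen : IsSymmGenerating S) (p x : G) {g : G} (hg : g ∈ S) :
    wordDist S p (x + g) ≤ wordDist S p x + 1 :=
  wordDist_le (hasPath_succ.2 ⟨x, hasPath_wordDist hgen p x, by simpa [Adj] using hg⟩)

theorem hasPath_translate {k : ℕ} {x y : G} (h : HasPath S k x y) (g : G) :
    HasPath S k (g + x) (g + y) := by
  obtain ⟨w, h0, h1, h2⟩ := h
  exact ⟨fun i => g + w i, congrArg (g + ·) h0, congrArg (g + ·) h1,
    fun i hi => by simpa [Adj] using h2 i hi⟩

theorem HasPath.trans {k l : ℕ} {x y z : G} (h : HasPath S k x y) (h' : HasPath S l y z) :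
    HasPath S (k + l) x z := by
  induction l generalizing z with
  | zero => exact hasPath_zero.1 h' ▸ h
  | succ l ih =>
    obtain ⟨t, ht, htz⟩ := hasPath_succ.1 h'
    exact hasPath_succ.2 ⟨t, ih ht, htz⟩

theorem wordDist_zero_add_le (hgen : IsSymmGenerating S) (g h : G) :
    wordDist S 0 (g + h) ≤ wordDist S 0 g + wordDist S 0 h := by
  refine wordDist_le ((hasPath_wordDist hgen 0 g).trans ?_)
  simpa using hasPath_translate (hasPath_wordDist hgen 0 h) g

theorem wordDist_eq_zero_sub (p x : G) : wordDist S p x = wordDist S 0 (x - p) := by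
  have : {k | HasPath S k p x} = {k | HasPath S k 0 (x - p)} := by
    ext k
    constructor
    · intro h
      simpa [sub_eq_neg_add] using hasPath_translate h (-p)
    · intro h
      simpa using hasPath_translate h p
  exact congrArg sInf this

theorem wordDist_zero_neg_le (hgen : IsSymmGenerating S) (g : G) :
    wordDist S 0 (-g) ≤ wordDist S 0 g := by
  have key : ∀ k, ∀ g : G, HasPath S k 0 g → HasPath S k 0 (-g) := by
    intro k
    induction k with
    | zero =>
      intro g h
      rw [← hasPath_zero.1 h, neg_zero]
      exact hasPath_zero.2 rfl
    | succ k ih =>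
      intro g h
      obtain ⟨z, hz, hzg⟩ := hasPath_succ.1 h
      refine hasPath_succ.2 ⟨-z, ih z hz, ?_⟩
      have := neg_mem_of_mem hgen hzg
      rw [Adj]
      convert this using 1
      abel
  exact wordDist_le (key _ g (hasPath_wordDist hgen 0 g))

theorem wordDist_zero_nsmul_le (hgen : IsSymmGenerating S) (g : G) (n : ℕ) :
    wordDist S 0 (n • g) ≤ n * wordDist S 0 g := by
  induction n with
  | zero => simpa using wordDist_le (hasPath_zero.2 (rfl : (0 : G) = 0))
  | succ n ih =>
    rw [succ_nsmul, add_mul, one_mul]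
    exact (wordDist_zero_add_le hgen _ _).trans (Nat.add_le_add_right ih _)

theorem wordDist_zero_zsmul_le (hgen : IsSymmGenerating S) (g : G) (n : ℤ) :
    wordDist S 0 (n • g) ≤ n.natAbs * wordDist S 0 g := by
  rcases Int.natAbs_eq n with h | h
  · conv_lhs => rw [h, natCast_zsmul]
    exact wordDist_zero_nsmul_le hgen g _
  · conv_lhs => rw [h, neg_smul, natCast_zsmul]
    exact (wordDist_zero_neg_le hgen _).trans (wordDist_zero_nsmul_le hgen g _)

theorem wordDist_zero_sum_le (hgen : IsSymmGenerating S) {κ : Type*} (t : Finset κ)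
    (f : κ → G) : wordDist S 0 (∑ i ∈ t, f i) ≤ ∑ i ∈ t, wordDist S 0 (f i) := by
  classical
  induction t using Finset.induction_on with
  | empty => simpa using wordDist_le (hasPath_zero.2 (rfl : (0 : G) = 0))
  | insert a t ha ih =>
    rw [Finset.sum_insert ha, Finset.sum_insert ha]
    exact (wordDist_zero_add_le hgen _ _).trans (Nat.add_le_add_left ih _)

/-- A function bounded by a monotone function of the distance stays so under the random walk. -/
theorem avg_pow_le_of_wordDist_le [Nonempty ι] (hS : S = Finset.univ.val.map s)
    (hgen : IsSymmGenerating S) (p : G) {F : ℕ → ℝ} (hF : Monotone F) {g : G → ℝ}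
    (hg : ∀ y, g y ≤ F (wordDist S p y)) (N : ℕ) (x : G) :
    (avg s ^ N) g x ≤ F (wordDist S p x + N) := by
  induction N generalizing g F with
  | zero => simpa using hg x
  | succ N ih =>
    rw [avg_pow_succ_apply]
    -- One step changes the distance by at most one, so `avg s g` satisfies the hypothesis with `F`
    -- shifted by one.
    have h := ih (F := fun j => F (j + 1)) (fun a b hab => hF (Nat.add_le_add_right hab 1))
      (g := avg s g) fun y => by
        have hc : (0 : ℝ) < Fintype.card ι := Nat.cast_pos.2 Fintype.card_pos
        rw [avg_apply, div_le_iff₀ hc, mul_comm]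
        have h1 : ∑ i, g (y + s i) ≤ ∑ _i : ι, F (wordDist S p y + 1) :=
          Finset.sum_le_sum fun i _ =>
            (hg _).trans (hF (wordDist_add_le hgen p y (by simp [hS])))
        simpa using h1
    exact h

/-- Polynomial functions of degree at most `k` grow at most like the `k`-th power of the
distance. -/
theorem exists_le_of_mem_polyFun (hS : S = Finset.univ.val.map s) (hgen : IsSymmGenerating S)
    (p : G) {k : ℕ} {u : G → ℝ} (hu : u ∈ polyFun G (k + 1)) :
    ∃ C : ℝ, 0 ≤ C ∧ ∀ x, |u x| ≤ C * ((wordDist S p x : ℝ) + 1) ^ k := by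
  -- Arbitrary path lengths replace the distance, so that one can induct along the path.
  suffices ∃ C : ℝ, 0 ≤ C ∧ ∀ n x, HasPath S n p x → |u x| ≤ C * ((n : ℝ) + 1) ^ k by
    obtain ⟨C, hC, h⟩ := this
    exact ⟨C, hC, fun x => h _ x (hasPath_wordDist hgen p x)⟩
  induction k generalizing u with
  | zero =>
    refine ⟨|u 0|, abs_nonneg _, fun n x _ => ?_⟩
    simp [mem_polyFun_one.1 hu x]
  | succ k ih =>
    choose C hC0 hC using fun i => ih (mem_polyFun_succ.1 hu (s i))
    set D := ∑ i, C i with hD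
    have hD0 : 0 ≤ D := Finset.sum_nonneg fun i _ => hC0 i
    refine ⟨|u p| + D, by positivity, fun n x hx => ?_⟩
    have h : |u x| ≤ |u p| + n * (D * ((n : ℝ) + 1) ^ k) := by
      induction n generalizing x with
      | zero => simp [hasPath_zero.1 hx]
      | succ n ihn =>
        obtain ⟨z, hz, hzx⟩ := hasPath_succ.1 hx
        obtain ⟨i, hi⟩ : ∃ i, s i = x - z := by simpa [hS, Adj] using hzx
        have h1 := hC i n z hz
        have h2 : C i ≤ D := Finset.single_le_sum (fun i _ => hC0 i) (Finset.mem_univ i)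
        have h3 : u x = u z + diff (s i) u z := by simp [hi]
        have h4 : C i * ((n : ℝ) + 1) ^ k ≤ D * (((n + 1 : ℕ) : ℝ) + 1) ^ k := by
          gcongr
          simp
        have h5 : D * ((n : ℝ) + 1) ^ k ≤ D * (((n + 1 : ℕ) : ℝ) + 1) ^ k := by
          gcongr
          simp
        have h6 := mul_le_mul_of_nonneg_left h5 (Nat.cast_nonneg (α := ℝ) n)
        rw [h3]
        refine (abs_add_le _ _).trans ?_
        have := ihn z hz
        push_cast at h4 h6 ⊢
        linarith
    have h1 : (1 : ℝ) ≤ ((n : ℝ) + 1) ^ (k + 1) :=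
      one_le_pow₀ (by linarith [Nat.cast_nonneg (α := ℝ) n])
    have h2 : (n : ℝ) * (D * ((n : ℝ) + 1) ^ k) ≤ D * ((n : ℝ) + 1) ^ (k + 1) := by
      have : 0 ≤ D * ((n : ℝ) + 1) ^ k := by positivity
      rw [pow_succ]
      nlinarith
    have h3 := mul_le_mul_of_nonneg_left h1 (abs_nonneg (u p))
    rw [add_mul]
    linarith

end WordMetric

end CayleyHarmonic

namespace CayleyHarmonic

/-! ### Lower bounds for multinomial coefficients near the centre. -/

section Multinomial

variable {ι : Type*} [Fintype ι]

/-- The Poisson weight `K^k / k!` is maximal at `k = K`. -/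
theorem factorial_mul_pow_le_factorial_mul_pow (K k : ℕ) :
    K.factorial * K ^ k ≤ k.factorial * K ^ K := by
  rcases le_total K k with h | h
  · calc K.factorial * K ^ k = K.factorial * K ^ (k - K) * K ^ K := by
          rw [mul_assoc, ← pow_add, Nat.sub_add_cancel h]
      _ ≤ _ := Nat.mul_le_mul_right _ (Nat.factorial_mul_pow_sub_le_factorial h)
  · obtain ⟨j, rfl⟩ := Nat.exists_eq_add_of_le h
    rw [← Nat.factorial_mul_ascFactorial, mul_assoc, pow_add (k + j) k j, mul_comm ((k + j) ^ k)]
    exact Nat.mul_le_mul_left _ (Nat.mul_le_mul_right _ (Nat.ascFactorial_le_pow_add k j))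

/-- Multiplying the preceding inequality over all indices cancels the powers of `K`, as the sums of
exponents agree. -/
theorem multinomial_le_multinomial_const (K : ℕ) {k : ι → ℕ}
    (hk : ∑ i, k i = Fintype.card ι * K) :
    Nat.multinomial Finset.univ k ≤ Nat.multinomial Finset.univ (fun _ : ι => K) := by
  have h1 := Nat.multinomial_spec Finset.univ k
  have h2 := Nat.multinomial_spec Finset.univ (fun _ : ι => K)
  have h3 : ∑ _i : ι, K = Fintype.card ι * K := by simp
  rw [h3, ← hk, ← h1] at h2
  have h4 : (∏ _i : ι, K.factorial) ≤ ∏ i, (k i).factorial := by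
    rcases Nat.eq_zero_or_pos K with rfl | hK
    · exact Finset.prod_le_prod' fun i _ => Nat.factorial_pos _
    have h5 : ∏ i, (K.factorial * K ^ k i) ≤ ∏ i, ((k i).factorial * K ^ K) :=
      Finset.prod_le_prod' fun i _ => factorial_mul_pow_le_factorial_mul_pow K (k i)
    rw [Finset.prod_mul_distrib, Finset.prod_mul_distrib, Finset.prod_pow_eq_pow_sum,
      Finset.prod_pow_eq_pow_sum, hk, h3] at h5
    exact Nat.le_of_mul_le_mul_right h5 (by positivity)
  have h5 : 0 < ∏ _i : ι, K.factorial := Finset.prod_pos fun _ _ => Nat.factorial_pos _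
  refine Nat.le_of_mul_le_mul_left ?_ h5
  rw [h2]
  exact Nat.mul_le_mul_right _ h4

/-- The power is the sum of at most `(r K + 1)^r` multinomial coefficients, `r` being the number of
indices, and the central one is the largest. -/
theorem card_pow_le_multinomial_const (K : ℕ) :
    Fintype.card ι ^ (Fintype.card ι * K) ≤
      (Fintype.card ι * K + 1) ^ Fintype.card ι *
        Nat.multinomial Finset.univ (fun _ : ι => K) := by
  classical
  have h1 := Finset.sum_pow_eq_sum_piAntidiag Finset.univ (fun _ : ι => 1) (Fintype.card ι * K)
  simp only [Finset.sum_const, Finset.card_univ, smul_eq_mul, mul_one, one_pow,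
    Finset.prod_const_one, Nat.cast_id] at h1
  rw [h1]
  have h2 : (Finset.piAntidiag Finset.univ (Fintype.card ι * K) : Finset (ι → ℕ)) ⊆
      Fintype.piFinset fun _ => Finset.range (Fintype.card ι * K + 1) := by
    intro k hk
    rw [Finset.mem_piAntidiag] at hk
    rw [Fintype.mem_piFinset]
    intro i
    rw [Finset.mem_range, Nat.lt_succ_iff, ← hk.1]
    exact Finset.single_le_sum (fun _ _ => Nat.zero_le _) (Finset.mem_univ i)
  have h3 := Finset.card_le_card h2
  rw [Fintype.card_piFinset] at h3
  simp only [Finset.card_range, Finset.prod_const, Finset.card_univ] at h3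
  refine (Finset.sum_le_card_nsmul _ _ _ fun k hk => ?_).trans (Nat.mul_le_mul_right _ h3)
  exact multinomial_le_multinomial_const K (Finset.mem_piAntidiag.1 hk).1

/-- `(1 + a/K)^a ≤ exp (a²/K) ≤ e < 3`. -/
theorem add_pow_le_three_mul_pow {K a : ℕ} (h : a ^ 2 ≤ K) : (K + a) ^ a ≤ 3 * K ^ a := by
  rcases Nat.eq_zero_or_pos K with rfl | hK
  · have : a = 0 := by simpa using h
    simp [this]
  have hK' : (0 : ℝ) < K := Nat.cast_pos.2 hK
  have h1 : (((K + a : ℕ) : ℝ) / K) ^ a ≤ 3 := by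
    have h2 : ((K + a : ℕ) : ℝ) / K ≤ Real.exp (a / K) := by
      refine le_trans (le_of_eq ?_) (Real.add_one_le_exp _)
      push_cast
      field_simp
      ring
    calc (((K + a : ℕ) : ℝ) / K) ^ a ≤ Real.exp (a / K) ^ a := by gcongr
      _ = Real.exp (a * (a / K)) := (Real.exp_nat_mul _ _).symm
      _ ≤ Real.exp 1 := by
        refine Real.exp_le_exp.2 ?_
        rw [← mul_div_assoc, div_le_one hK', ← sq]
        exact_mod_cast h
      _ ≤ 3 := Real.exp_one_lt_three.le
  rw [div_pow, div_le_iff₀ (by positivity)] at h1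
  exact_mod_cast h1

/-- A displacement of size at most `√K` in each index costs only a factor `3` per index against the
central coefficient. The probability of these step counts is thus at least polynomially small in
`K`. -/
theorem card_pow_le_multinomial {K : ℕ} {a : ι → ℕ} (ha : ∀ i, a i ^ 2 ≤ K) :
    Fintype.card ι ^ (Fintype.card ι * K + ∑ i, a i) ≤
      (Fintype.card ι * K + 1) ^ Fintype.card ι * 3 ^ Fintype.card ι *
        Nat.multinomial Finset.univ (fun i => K + a i) := by
  rcases Nat.eq_zero_or_pos K with rfl | hK
  · have : ∀ i, a i = 0 := fun i => by simpa using ha i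
    simp only [this]
    have h0 := card_pow_le_multinomial_const (ι := ι) 0
    refine le_trans ?_ (h0.trans ?_)
    · simp
    · rw [mul_assoc]
      refine Nat.mul_le_mul_left _ ?_
      exact Nat.le_mul_of_pos_left _ (by positivity)
  set r := Fintype.card ι with hr
  set M := Nat.multinomial Finset.univ (fun i => K + a i) with hM
  set M₀ := Nat.multinomial Finset.univ (fun _ : ι => K) with hM₀
  have h1 : (∏ i, (K + a i).factorial) * M = (r * K + ∑ i, a i).factorial := by
    rw [hM, Nat.multinomial_spec, Finset.sum_add_distrib]
    simp [hr]
  have h2 : (∏ _i : ι, K.factorial) * M₀ = (r * K).factorial := by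
    rw [hM₀, Nat.multinomial_spec]
    simp [hr]
  have h3 : (r * K).factorial * (r * K) ^ (∑ i, a i) ≤ (r * K + ∑ i, a i).factorial :=
    le_trans (Nat.mul_le_mul_left _ (Nat.pow_le_pow_left (Nat.le_succ _) _))
      Nat.factorial_mul_pow_le_factorial
  have h4 : ∏ i, (K + a i).factorial ≤
      (∏ _i : ι, K.factorial) * (3 ^ r * K ^ (∑ i, a i)) := by
    have : ∀ i ∈ Finset.univ, (K + a i).factorial ≤ K.factorial * (3 * K ^ a i) := by
      intro i _
      rw [← Nat.factorial_mul_ascFactorial]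
      exact Nat.mul_le_mul_left _
        ((Nat.ascFactorial_le_pow_add _ _).trans (add_pow_le_three_mul_pow (ha i)))
    refine (Finset.prod_le_prod' this).trans (le_of_eq ?_)
    rw [Finset.prod_mul_distrib, Finset.prod_mul_distrib, Finset.prod_pow_eq_pow_sum,
      Finset.prod_const, Finset.prod_const, Finset.card_univ]
  have h5 : M₀ * r ^ (∑ i, a i) ≤ 3 ^ r * M := by
    have hpos : 0 < (∏ _i : ι, K.factorial) * K ^ (∑ i, a i) :=
      Nat.mul_pos (Finset.prod_pos fun _ _ => Nat.factorial_pos _) (by positivity)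
    refine Nat.le_of_mul_le_mul_left ?_ hpos
    calc ((∏ _i : ι, K.factorial) * K ^ (∑ i, a i)) * (M₀ * r ^ (∑ i, a i))
        = ((∏ _i : ι, K.factorial) * M₀) * (r * K) ^ (∑ i, a i) := by rw [mul_pow]; ring
      _ ≤ (∏ i, (K + a i).factorial) * M := by rw [h2, h1]; exact h3
      _ ≤ ((∏ _i : ι, K.factorial) * (3 ^ r * K ^ (∑ i, a i))) * M :=
          Nat.mul_le_mul_right _ h4
      _ = _ := by ring
  calc r ^ (r * K + ∑ i, a i) = r ^ (r * K) * r ^ (∑ i, a i) := pow_add _ _ _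
    _ ≤ ((r * K + 1) ^ r * M₀) * r ^ (∑ i, a i) :=
        Nat.mul_le_mul_right _ (card_pow_le_multinomial_const K)
    _ = (r * K + 1) ^ r * (M₀ * r ^ (∑ i, a i)) := by ring
    _ ≤ (r * K + 1) ^ r * (3 ^ r * M) := Nat.mul_le_mul_left _ h5
    _ = _ := by ring

end Multinomial

/-! ### From a one-sided to a crude two-sided bound. -/

section Harnack

variable {G : Type*} [AddCommGroup G]

/-- The representation of `G` on functions by translations. -/
def translation : Multiplicative G →* Module.End ℝ (G → ℝ) where
  toFun g := LinearMap.funLeft ℝ ℝ fun x => x + g.toAdd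
  map_one' := by
    ext f x
    simp [LinearMap.funLeft_apply]
  map_mul' g h := by
    ext f x
    simp [LinearMap.funLeft_apply, add_assoc]

theorem translation_apply (g : Multiplicative G) (f : G → ℝ) (x : G) :
    translation g f x = f (x + g.toAdd) := rfl

variable {ι : Type*} [Fintype ι] {s : ι → G}

theorem avg_eq_smul_sum (s : ι → G) :
    avg s = (Fintype.card ι : ℝ)⁻¹ • ∑ i, translation (Multiplicative.ofAdd (s i)) := by
  ext f x
  simp [avg_apply, LinearMap.sum_apply, translation_apply, div_eq_inv_mul]

/-- Translations commute, so `P^n` expands by the multinomial theorem; as `f ≥ 0`, a single term can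
be kept. -/
theorem multinomial_mul_le_avg_pow [Nonempty ι] (s : ι → G) (k : ι → ℕ) {f : G → ℝ} (hf : 0 ≤ f)
    (p : G) :
    (Nat.multinomial Finset.univ k : ℝ) * f (p + ∑ i, k i • s i) ≤
      (Fintype.card ι : ℝ) ^ (∑ i, k i) * (avg s ^ (∑ i, k i)) f p := by
  classical
  have hc : (Fintype.card ι : ℝ) ≠ 0 := Nat.cast_ne_zero.2 Fintype.card_ne_zero
  have hcomm : ((Finset.univ : Finset ι) : Set ι).Pairwise
      (Function.onFun Commute fun i => translation (Multiplicative.ofAdd (s i))) :=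
    fun i _ j _ _ => (Commute.all (Multiplicative.ofAdd (s i)) _).map translation
  have hprod : ∀ l : ι → ℕ, ∀ h, Finset.univ.noncommProd
      (fun i => translation (Multiplicative.ofAdd (s i)) ^ l i) h =
        translation (Multiplicative.ofAdd (∑ i, l i • s i)) := by
    intro l h
    rw [ofAdd_sum, ← Finset.noncommProd_eq_prod (β := Multiplicative G)]
    refine Eq.trans ?_ (Finset.map_noncommProd Finset.univ
      (fun i => Multiplicative.ofAdd (l i • s i)) (fun _ _ _ _ _ => Commute.all _ _)
      translation).symm
    exact Finset.noncommProd_congr rfl (fun i _ => by rw [ofAdd_nsmul, map_pow]) _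
  rw [avg_eq_smul_sum, smul_pow, Finset.sum_pow_eq_sum_piAntidiag_of_commute _ _ hcomm,
    LinearMap.smul_apply, Pi.smul_apply, smul_eq_mul, inv_pow,
    mul_inv_cancel_left₀ (pow_ne_zero _ hc), LinearMap.sum_apply, Finset.sum_apply]
  have happ : ∀ l : ι → ℕ, ∀ h, ((Nat.multinomial Finset.univ l : Module.End ℝ (G → ℝ)) *
      Finset.univ.noncommProd
        (fun i => translation (Multiplicative.ofAdd (s i)) ^ l i) h) f p =
      (Nat.multinomial Finset.univ l : ℝ) * f (p + ∑ i, l i • s i) := by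
    intro l h
    rw [hprod, Module.End.mul_apply, ← nsmul_one, LinearMap.smul_apply]
    simp [translation_apply]
  simp only [happ]
  refine Finset.single_le_sum (f := fun l : ι → ℕ =>
    (Nat.multinomial Finset.univ l : ℝ) * f (p + ∑ i, l i • s i)) (fun l _ => ?_) ?_
  · exact mul_nonneg (Nat.cast_nonneg _) (hf _)
  · simp [Finset.mem_piAntidiag]

theorem wordDist_self {S : Multiset G} (p : G) : wordDist S p p = 0 :=
  Nat.le_zero.1 (wordDist_le (hasPath_zero.2 rfl))

/-- The random walk expectation of `|u|` is controlled by that of a lower bound of `u`. -/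
theorem avg_pow_abs_le [Nonempty ι] (s : ι → G) {u g : G → ℝ} (hu : avg s u = u)
    (hg : 0 ≤ g) (h : ∀ x, -g x ≤ u x) (N : ℕ) (p : G) :
    (avg s ^ N) |u| p ≤ u p + 2 * (avg s ^ N) g p := by
  have h1 : |u| ≤ u + (2 : ℝ) • g := by
    intro x
    have := h x
    have := hg x
    simp only [Pi.abs_apply, Pi.add_apply, Pi.smul_apply, smul_eq_mul, Pi.zero_apply] at *
    rw [abs_le]
    constructor <;> linarith
  refine (avg_pow_mono s N h1 p).trans (le_of_eq ?_)
  rw [map_add, map_smul, avg_pow_eq_self s N hu]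
  simp

/-- This stands in for a Harnack inequality: only some polynomial growth is needed, so the exponent
is left far from optimal. -/
theorem exists_abs_le_of_one_sided [Nonempty ι] {S : Multiset G}
    (hS : S = Finset.univ.val.map s) (hgen : IsSymmGenerating S) (p : G) {d : ℝ} (hd : 0 ≤ d)
    {u : G → ℝ} (hu : avg s u = u) {C : ℝ}
    (hC : ∀ x, u x ≥ -C * ((wordDist S p x : ℝ) + 1) ^ d) :
    ∃ (D : ℕ) (C' : ℝ), ∀ x, |u x| ≤ C' * ((wordDist S p x : ℝ) + 1) ^ D := by
  set r := Fintype.card ι with hr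
  set e := ⌈d⌉₊ with he
  set c := |u p| + 2 * |C| with hc
  have hc0 : 0 ≤ c := by positivity
  refine ⟨2 * (r + e), 3 ^ r * c * (2 * r + 1) ^ (r + e), fun y => ?_⟩
  set N := wordDist S p y with hN
  obtain ⟨a, haN, hay⟩ := (hasPath_iff hS).1 (hasPath_wordDist hgen p y)
  rw [← hN] at haN
  -- Each step is padded with `K` extra uses. Symmetry gives `2 ∑ s i = 0`, so an even `K` leaves
  -- the endpoint unchanged; and `a i ≤ N` gives `a i ^ 2 ≤ K`.
  set K := 2 * N ^ 2 with hK
  have haK : ∀ i, a i ^ 2 ≤ K := by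
    intro i
    have : a i ≤ N := haN ▸ Finset.single_le_sum (fun _ _ => Nat.zero_le _) (Finset.mem_univ i)
    have := Nat.pow_le_pow_left this 2
    omega
  have hsum : ∑ i, (K + a i) = r * K + N := by
    rw [Finset.sum_add_distrib, haN]
    simp [hr]
  have hend : p + ∑ i, (K + a i) • s i = y := by
    have h2 : (2 : ℕ) • ∑ i, s i = 0 := by
      have := sum_comp_neg hS hgen (id : G → G)
      simp only [id, Finset.sum_neg_distrib] at this
      rw [two_nsmul]
      nth_rewrite 1 [this]
      exact neg_add_cancel _
    have h3 : ∑ i, K • s i = 0 := by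
      rw [← Finset.smul_sum, hK, mul_comm, mul_smul, h2, smul_zero]
    simp only [add_smul, Finset.sum_add_distrib, h3, zero_add, hay]
  have h1 := multinomial_mul_le_avg_pow s (fun i => K + a i) (abs_nonneg u) p
  have h2 := card_pow_le_multinomial haK
  simp only [hsum, hend, haN, ← hr] at h1 h2
  set n := r * K + N with hn
  set M := Nat.multinomial Finset.univ fun i => K + a i with hM
  have hM0 : (0 : ℝ) < M := Nat.cast_pos.2 (Nat.multinomial_pos _ _)
  have h2' : (r : ℝ) ^ n ≤ ((r : ℝ) * K + 1) ^ r * 3 ^ r * M := by exact_mod_cast h2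
  have hF : Monotone fun j : ℕ => |C| * ((j : ℝ) + 1) ^ d := by
    intro i j hij
    have : (i : ℝ) ≤ j := Nat.cast_le.2 hij
    dsimp only
    gcongr
  have h3 : (avg s ^ n) |u| p ≤ u p + 2 * (|C| * ((n : ℝ) + 1) ^ d) := by
    refine (avg_pow_abs_le s hu (g := fun x => |C| * ((wordDist S p x : ℝ) + 1) ^ d)
      (fun x => by simp only [Pi.zero_apply]; positivity) (fun x => ?_) n p).trans ?_
    · refine le_trans ?_ (hC x)
      rw [← neg_mul]
      gcongr
      exact le_abs_self C
    · have := avg_pow_le_of_wordDist_le hS hgen p hF (fun y => le_rfl) n p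
      rw [wordDist_self, zero_add] at this
      linarith
  have hn1 : (1 : ℝ) ≤ (n : ℝ) + 1 := by linarith [Nat.cast_nonneg (α := ℝ) n]
  have h4 : (avg s ^ n) |u| p ≤ c * ((n : ℝ) + 1) ^ e := by
    have h5 : ((n : ℝ) + 1) ^ d ≤ ((n : ℝ) + 1) ^ e := by
      rw [← Real.rpow_natCast]
      exact Real.rpow_le_rpow_of_exponent_le hn1 (Nat.le_ceil d)
    have h6 : (1 : ℝ) ≤ ((n : ℝ) + 1) ^ e := one_le_pow₀ hn1
    have h7 := mul_le_mul_of_nonneg_left h6 (abs_nonneg (u p))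
    have h8 := mul_le_mul_of_nonneg_left h5 (abs_nonneg C)
    rw [hc, add_mul]
    linarith [le_abs_self (u p)]
  set B : ℝ := (2 * r + 1) * ((N : ℝ) + 1) ^ 2 with hB
  have hN0 : (0 : ℝ) ≤ N := Nat.cast_nonneg _
  have hr0 : (0 : ℝ) ≤ r := Nat.cast_nonneg _
  have hKN : (K : ℝ) = 2 * (N : ℝ) ^ 2 := by simp [hK]
  have hB1 : (r : ℝ) * K + 1 ≤ B := by
    rw [hB, hKN]
    nlinarith [mul_nonneg hr0 hN0]
  have hB2 : (n : ℝ) + 1 ≤ B := by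
    have : (n : ℝ) = r * K + N := by simp [hn]
    rw [this, hB, hKN]
    nlinarith [mul_nonneg hr0 hN0]
  have h5 : |u y| ≤ ((r : ℝ) * K + 1) ^ r * 3 ^ r * (c * ((n : ℝ) + 1) ^ e) := by
    refine le_of_mul_le_mul_left ?_ hM0
    calc (M : ℝ) * |u y| ≤ (r : ℝ) ^ n * (avg s ^ n) |u| p := h1
      _ ≤ (((r : ℝ) * K + 1) ^ r * 3 ^ r * M) * (c * ((n : ℝ) + 1) ^ e) := by
        gcongr
        exact avg_pow_nonneg s n (abs_nonneg u) p
      _ = _ := by ring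
  calc |u y| ≤ ((r : ℝ) * K + 1) ^ r * 3 ^ r * (c * ((n : ℝ) + 1) ^ e) := h5
    _ ≤ B ^ r * 3 ^ r * (c * B ^ e) := by gcongr
    _ = 3 ^ r * c * (2 * r + 1) ^ (r + e) * ((N : ℝ) + 1) ^ (2 * (r + e)) := by
      have : B ^ r * 3 ^ r * (c * B ^ e) = 3 ^ r * c * B ^ (r + e) := by rw [pow_add]; ring
      rw [this, hB, mul_pow, ← pow_mul]
      ring

end Harnack

end CayleyHarmonic

namespace CayleyHarmonic

/-! ### The Liouville theorem with the sharp degree. -/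

section Liouville

variable {G : Type*} [AddCommGroup G] {ι : Type*} [Fintype ι] [Nonempty ι] {s : ι → G}
  {S : Multiset G}

/-- Harmonic functions of polynomial growth are polynomial functions. -/
theorem mem_polyFun_of_abs_le (hS : S = Finset.univ.val.map s) (hgen : IsSymmGenerating S) (p : G)
    {u : G → ℝ} (hu : avg s u = u) {D : ℕ} {C : ℝ}
    (hC : ∀ x, |u x| ≤ C * ((wordDist S p x : ℝ) + 1) ^ D) : u ∈ polyFun G (2 * D + 1) := by
  refine mem_polyFun_of_carreDuChamp_eq_zero (closure_range hS hgen) ?_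
  funext x
  refine le_antisymm ?_ (carreDuChamp_nonneg s _ u x)
  by_contra! hpos
  rw [Pi.zero_apply] at hpos
  set k := 2 * D + 1 with hk
  set c := carreDuChamp s k u x with hc
  set j := wordDist S p x with hj
  have hF : Monotone fun i : ℕ => C ^ 2 * ((i : ℝ) + 1) ^ (2 * D) := by
    intro a b hab
    have : (a : ℝ) ≤ b := Nat.cast_le.2 hab
    dsimp only
    gcongr
  have hsq : ∀ y, (u ^ 2) y ≤ C ^ 2 * ((wordDist S p y : ℝ) + 1) ^ (2 * D) := by
    intro y
    have h1 := pow_le_pow_left₀ (abs_nonneg (u y)) (hC y) 2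
    rwa [sq_abs, mul_pow, ← pow_mul, mul_comm D] at h1
  set B : ℝ := C ^ 2 * ((j : ℝ) + k + 1) ^ (2 * D) * k.factorial with hB
  obtain ⟨t, ht⟩ := exists_nat_gt (B / c)
  rw [div_lt_iff₀ hpos] at ht
  have h1 := (choose_mul_carreDuChamp_le s (k + t) k hu x).trans
    (avg_pow_le_of_wordDist_le hS hgen p hF hsq (k + t) x)
  have h2 : ((t : ℝ) + 1) ^ k / k.factorial ≤ ((k + t).choose k : ℝ) := by
    have := Nat.pow_le_choose (α := ℝ) k (k + t)
    have h3 : k + t + 1 - k = t + 1 := by omega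
    rw [h3] at this
    exact_mod_cast this
  have hfac : (0 : ℝ) < k.factorial := Nat.cast_pos.2 k.factorial_pos
  have ht0 : (0 : ℝ) ≤ t := Nat.cast_nonneg t
  have hj0 : (0 : ℝ) ≤ j := Nat.cast_nonneg j
  have hk0 : (0 : ℝ) ≤ k := Nat.cast_nonneg k
  have h4 : ((t : ℝ) + 1) ^ k * c ≤ B * ((t : ℝ) + 1) ^ (2 * D) := by
    have h5 := (mul_le_mul_of_nonneg_right h2 hpos.le).trans h1
    rw [div_mul_eq_mul_div, div_le_iff₀ hfac] at h5
    refine h5.trans ?_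
    have h6 : (((j + (k + t) : ℕ) : ℝ) + 1) ^ (2 * D) ≤
        (((j : ℝ) + k + 1) * ((t : ℝ) + 1)) ^ (2 * D) := by
      gcongr
      push_cast
      nlinarith [mul_nonneg hj0 ht0, mul_nonneg hk0 ht0]
    have h7 := mul_le_mul_of_nonneg_right
      (mul_le_mul_of_nonneg_left h6 (sq_nonneg C)) hfac.le
    rw [mul_pow] at h7
    refine h7.trans (le_of_eq ?_)
    rw [hB]
    ring
  rw [hk, pow_succ, mul_assoc, mul_comm B] at h4
  have h8 := le_of_mul_le_mul_left h4 (by positivity)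
  nlinarith

/-- Splitting at `|a| = A` bounds a second moment by a first and a fourth one, with a free
parameter. -/
theorem sq_le_mul_abs_add {A : ℝ} (hA : 0 < A) (a : ℝ) :
    a ^ 2 ≤ A * |a| + (A ^ 2)⁻¹ * a ^ 4 := by
  have h4 : 0 ≤ (A ^ 2)⁻¹ * a ^ 4 := by positivity
  rcases le_total |a| A with h | h
  · have := mul_le_mul_of_nonneg_right h (abs_nonneg a)
    rw [abs_mul_abs_self] at this
    nlinarith
  · have h1 : A ^ 2 ≤ a ^ 2 := by
      rw [← sq_abs a]
      gcongr
    have h2 : a ^ 2 ≤ (A ^ 2)⁻¹ * a ^ 4 := by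
      rw [inv_mul_eq_div, le_div_iff₀ (by positivity)]
      nlinarith [sq_nonneg a]
    have h3 : 0 ≤ A * |a| := by positivity
    linarith

/-- It replaces a real power by an integral one, to which the moment bounds for polynomial functions
apply. -/
theorem rpow_le_one_add_pow {x a : ℝ} {n : ℕ} (hx : 0 ≤ x) (ha : 0 ≤ a) (han : a ≤ n) :
    x ^ a ≤ 1 + x ^ n := by
  rcases le_total x 1 with h | h
  · have := Real.rpow_le_one hx h ha
    have := pow_nonneg hx n
    linarith
  · have := Real.rpow_le_rpow_of_exponent_le h han
    rw [Real.rpow_natCast] at this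
    linarith

/-- A harmonic polynomial function of degree at most `n` which is bounded below by a power less
than `n` of the distance has degree less than `n`. -/
theorem mem_polyFun_of_mem_succ (hS : S = Finset.univ.val.map s) (hgen : IsSymmGenerating S)
    (p : G) {w : G → ℝ} (hw : w ∈ polyFun G 3) (hpw : ∀ x, ((wordDist S p x : ℝ) + 1) ^ 2 ≤ w x)
    {d : ℝ} (hd : 0 ≤ d) {u : G → ℝ} (hu : avg s u = u) {C : ℝ}
    (hC : ∀ x, u x ≥ -C * ((wordDist S p x : ℝ) + 1) ^ d) {n : ℕ} (hdn : d < n)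
    (hun : u ∈ polyFun G (n + 1)) : u ∈ polyFun G n := by
  have hsymm : ∀ f : G → ℝ, ∑ i, f (s i) = ∑ i, f (-s i) := sum_comp_neg hS hgen
  have hw0 : ∀ x, 0 ≤ w x := fun x => (sq_nonneg _).trans (hpw x)
  set c := carreDuChamp s n u p with hc
  by_cases hc0 : c = 0
  · refine mem_polyFun_of_carreDuChamp_eq_zero (closure_range hS hgen) ?_
    funext x
    rw [carreDuChamp_eq_of_mem_polyFun s hun x, ← carreDuChamp_eq_of_mem_polyFun s hun p]
    exact hc0
  exfalso
  have hcpos : 0 < c := lt_of_le_of_ne (carreDuChamp_nonneg s n u p) (Ne.symm hc0)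
  obtain ⟨C₁, hC₁0, hC₁⟩ := avg_pow_le_of_mem_polyFun hsymm p (n := n) (v := w ^ n)
    (by simpa [mul_comm] using pow_mem_polyFun hw n)
  obtain ⟨C₂, hC₂0, hC₂⟩ := avg_pow_le_of_mem_polyFun hsymm p (n := 2 * n) (v := u ^ 4)
    (by simpa [← mul_assoc] using pow_mem_polyFun hun 4)
  have hgrow : ∀ (t : ℕ), 1 ≤ t → ∀ k : ℕ,
      (((t ^ 2 : ℕ) : ℝ) + 1) ^ k ≤ 2 ^ k * (t : ℝ) ^ (2 * k) := by
    intro t ht k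
    have ht' : (1 : ℝ) ≤ t := by exact_mod_cast ht
    rw [pow_mul, ← mul_pow]
    push_cast
    gcongr
    nlinarith
  set C₃ := |u p| + 2 * (|C| * (1 + C₁ * 2 ^ n)) with hC₃
  have hC₃0 : 0 ≤ C₃ := by positivity
  -- After `t²` steps the distance is typically of order `t`: the lower bound is dominated by `|C|
  -- t^d (1 + w^n / t^(2n))`, and the mean of `w^n` is `O(t^(2n))`.
  have habs : ∀ t : ℕ, 1 ≤ t → (avg s ^ (t ^ 2)) |u| p ≤ C₃ * (t : ℝ) ^ d := by
    intro t ht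
    have ht' : (1 : ℝ) ≤ t := by exact_mod_cast ht
    have ht0 : (0 : ℝ) < t := by linarith
    have h1 := avg_pow_abs_le s hu
      (g := (|C| * (t : ℝ) ^ d) • ((fun _ => 1) + ((t : ℝ) ^ (2 * n))⁻¹ • w ^ n))
      (fun x => by
        have := hw0 x
        simp only [Pi.zero_apply, Pi.smul_apply, Pi.add_apply, smul_eq_mul, Pi.pow_apply]
        positivity)
      (fun x => by
        refine le_trans ?_ (hC x)
        simp only [Pi.smul_apply, Pi.add_apply, smul_eq_mul, Pi.pow_apply]
        rw [neg_mul, neg_le_neg_iff, mul_assoc]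
        have h2 : ((wordDist S p x : ℝ) + 1) ^ d ≤
            (t : ℝ) ^ d * (1 + ((t : ℝ) ^ (2 * n))⁻¹ * w x ^ n) := by
          have h3 : ((wordDist S p x : ℝ) + 1) ^ d ≤ w x ^ (d / 2) := by
            have h4 : ((wordDist S p x : ℝ) + 1) ^ d =
                (((wordDist S p x : ℝ) + 1) ^ 2) ^ (d / 2) := by
              rw [← Real.rpow_natCast_mul (by positivity)]
              congr 1
              push_cast
              ring
            rw [h4]
            exact Real.rpow_le_rpow (by positivity) (hpw x) (by positivity)
          have h5 : w x ^ (d / 2) = (t : ℝ) ^ d * (w x / (t : ℝ) ^ 2) ^ (d / 2) := by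
            have h6 : (t : ℝ) ^ d = ((t : ℝ) ^ 2) ^ (d / 2) := by
              rw [← Real.rpow_natCast_mul (by positivity)]
              congr 1
              push_cast
              ring
            rw [h6, ← Real.mul_rpow (by positivity) (div_nonneg (hw0 x) (by positivity)),
              mul_div_cancel₀ _ (by positivity)]
          have h7 : (w x / (t : ℝ) ^ 2) ^ (d / 2) ≤ 1 + (w x / (t : ℝ) ^ 2) ^ n :=
            rpow_le_one_add_pow (div_nonneg (hw0 x) (by positivity)) (by positivity)
              (by linarith)
          rw [div_pow, ← pow_mul, div_eq_inv_mul (w x ^ n)] at h7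
          rw [h5] at h3
          exact h3.trans (mul_le_mul_of_nonneg_left h7 (by positivity))
        have h8 : 0 ≤ ((wordDist S p x : ℝ) + 1) ^ d := by positivity
        exact mul_le_mul (le_abs_self C) h2 h8 (abs_nonneg C)) (t ^ 2) p
    rw [map_smul, map_add, map_smul, avg_pow_const] at h1
    simp only [Pi.smul_apply, Pi.add_apply, smul_eq_mul] at h1
    have h2 : ((t : ℝ) ^ (2 * n))⁻¹ * (avg s ^ (t ^ 2)) (w ^ n) p ≤ C₁ * 2 ^ n := by
      rw [inv_mul_le_iff₀ (by positivity)]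
      refine (le_abs_self _).trans ((hC₁ _).trans ?_)
      have := mul_le_mul_of_nonneg_left (hgrow t ht n) hC₁0
      linarith
    have h3 : (1 : ℝ) ≤ (t : ℝ) ^ d := Real.one_le_rpow ht' hd
    have h4 := mul_le_mul_of_nonneg_left h3 (abs_nonneg (u p))
    have h5 : (|C| * (t : ℝ) ^ d) * (1 + ((t : ℝ) ^ (2 * n))⁻¹ * (avg s ^ (t ^ 2)) (w ^ n) p) ≤
        (|C| * (t : ℝ) ^ d) * (1 + C₁ * 2 ^ n) := by
      gcongr
    rw [hC₃]
    have h6 := le_abs_self (u p)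
    nlinarith
  set C₅ := C₂ * 2 ^ (2 * n) with hC₅
  have hC₅0 : 0 ≤ C₅ := by positivity
  set c₀ := c / (2 ^ n * n.factorial) with hc₀
  have hfac : (0 : ℝ) < n.factorial := Nat.cast_pos.2 n.factorial_pos
  have hc₀pos : 0 < c₀ := by positivity
  -- Chosen so large that the fourth-moment term absorbs at most half of the lower bound `c₀ t^(2n)`
  -- for the second moment.
  set M := 1 + 2 * C₅ / c₀ with hM
  have hM1 : 1 ≤ M := by
    have : 0 ≤ 2 * C₅ / c₀ := by positivity
    linarith
  have hM0 : 0 < M := by linarith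
  have hMC : (M ^ 2)⁻¹ * C₅ ≤ c₀ / 2 := by
    rw [inv_mul_le_iff₀ (by positivity)]
    have h1 : 2 * C₅ / c₀ ≤ M ^ 2 := by nlinarith
    rw [div_le_iff₀ hc₀pos] at h1
    linarith
  have hmain : ∀ t : ℕ, n + 1 ≤ t → c₀ / 2 * (t : ℝ) ^ ((n : ℝ) - d) ≤ M * C₃ := by
    intro t ht
    have ht1 : 1 ≤ t := by omega
    have ht0 : (0 : ℝ) < t := by exact_mod_cast ht1
    have hlow : c₀ * (t : ℝ) ^ (2 * n) ≤ (avg s ^ (t ^ 2)) (u ^ 2) p := by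
      refine le_trans ?_ (choose_mul_carreDuChamp_le s (t ^ 2) n hu p)
      have h1 := Nat.pow_le_choose (α := ℝ) n (t ^ 2)
      have h2 : ((t : ℝ) ^ 2 / 2) ^ n ≤ (((t ^ 2 + 1 - n : ℕ) ^ n : ℕ) : ℝ) := by
        have h3 : n ≤ t ^ 2 + 1 := by nlinarith
        rw [Nat.cast_pow, Nat.cast_sub h3]
        gcongr
        have : (n : ℝ) + 1 ≤ t := by exact_mod_cast ht
        push_cast
        nlinarith [sq_nonneg ((t : ℝ) - 1)]
      have h4 : c₀ * (t : ℝ) ^ (2 * n) = ((t : ℝ) ^ 2 / 2) ^ n / n.factorial * c := by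
        rw [hc₀, div_pow, ← pow_mul]
        field_simp
      rw [h4]
      refine mul_le_mul_of_nonneg_right (le_trans ?_ h1) hcpos.le
      refine div_le_div_of_nonneg_right ?_ hfac.le
      exact_mod_cast h2
    -- The splitting level is `M` times the natural size `t^n` of a function of degree `n`.
    have hA : 0 < M * (t : ℝ) ^ n := by positivity
    have hup : (avg s ^ (t ^ 2)) (u ^ 2) p ≤ (M * (t : ℝ) ^ n) * (avg s ^ (t ^ 2)) |u| p +
        ((M * (t : ℝ) ^ n) ^ 2)⁻¹ * (avg s ^ (t ^ 2)) (u ^ 4) p := by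
      have h1 : u ^ 2 ≤ (M * (t : ℝ) ^ n) • |u| + ((M * (t : ℝ) ^ n) ^ 2)⁻¹ • u ^ 4 :=
        fun x => sq_le_mul_abs_add hA (u x)
      have h2 := avg_pow_mono s (t ^ 2) h1 p
      rwa [map_add, map_smul, map_smul] at h2
    have h4 : ((M * (t : ℝ) ^ n) ^ 2)⁻¹ * (avg s ^ (t ^ 2)) (u ^ 4) p ≤
        c₀ / 2 * (t : ℝ) ^ (2 * n) := by
      have h5 : (avg s ^ (t ^ 2)) (u ^ 4) p ≤ C₅ * (t : ℝ) ^ (2 * (2 * n)) := by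
        refine (le_abs_self _).trans ((hC₂ _).trans ?_)
        have := mul_le_mul_of_nonneg_left (hgrow t ht1 (2 * n)) hC₂0
        rw [hC₅]
        linarith
      calc ((M * (t : ℝ) ^ n) ^ 2)⁻¹ * (avg s ^ (t ^ 2)) (u ^ 4) p
          ≤ ((M * (t : ℝ) ^ n) ^ 2)⁻¹ * (C₅ * (t : ℝ) ^ (2 * (2 * n))) := by gcongr
        _ = ((M ^ 2)⁻¹ * C₅) * (t : ℝ) ^ (2 * n) := by
          have : (t : ℝ) ^ (2 * (2 * n)) = (t : ℝ) ^ (2 * n) * ((t : ℝ) ^ n) ^ 2 := by ring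
          rw [this]
          field_simp
        _ ≤ _ := by gcongr
    have h6 := mul_le_mul_of_nonneg_left (habs t ht1) hA.le
    have h7 : c₀ / 2 * (t : ℝ) ^ (2 * n) ≤ (M * (t : ℝ) ^ n) * (C₃ * (t : ℝ) ^ d) := by
      linarith
    have h8 : (t : ℝ) ^ (2 * n) = (t : ℝ) ^ n * ((t : ℝ) ^ d * (t : ℝ) ^ ((n : ℝ) - d)) := by
      rw [← Real.rpow_add ht0, add_sub_cancel, Real.rpow_natCast, two_mul, pow_add]
    rw [h8] at h7
    have h9 : 0 < (t : ℝ) ^ n * (t : ℝ) ^ d := by positivity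
    refine le_of_mul_le_mul_left ?_ h9
    linarith
  have hlim := (tendsto_rpow_atTop (sub_pos.2 hdn)).comp tendsto_natCast_atTop_atTop
  obtain ⟨t, ht1, ht2⟩ := ((hlim.eventually_gt_atTop (M * C₃ / (c₀ / 2))).and
    (Filter.eventually_ge_atTop (n + 1))).exists
  have h1 := hmain t ht2
  rw [Function.comp_apply, div_lt_iff₀ (by positivity)] at ht1
  linarith

/-- Harmonic functions bounded below by a power of the distance are polynomial functions. -/
theorem mem_polyFun_of_one_sided (hS : S = Finset.univ.val.map s) (hgen : IsSymmGenerating S)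
    (p : G) {w : G → ℝ} (hw : w ∈ polyFun G 3) (hpw : ∀ x, ((wordDist S p x : ℝ) + 1) ^ 2 ≤ w x)
    {d : ℝ} (hd : 0 ≤ d) {u : G → ℝ} (hu : avg s u = u) {C : ℝ}
    (hC : ∀ x, u x ≥ -C * ((wordDist S p x : ℝ) + 1) ^ d) : u ∈ polyFun G (⌊d⌋₊ + 1) := by
  obtain ⟨D, C', hC'⟩ := exists_abs_le_of_one_sided hS hgen p hd hu hC
  have h1 := mem_polyFun_of_abs_le hS hgen p hu hC'
  -- The degree descends one at a time from the crude bound, as long as it exceeds `d`.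
  have h2 : ∀ j, u ∈ polyFun G (⌊d⌋₊ + 1 + j) → u ∈ polyFun G (⌊d⌋₊ + 1) := by
    intro j
    induction j with
    | zero => exact id
    | succ j ih =>
      intro h
      refine ih (mem_polyFun_of_mem_succ hS hgen p hw hpw hd hu hC ?_ h)
      have := Nat.lt_floor_add_one d
      push_cast
      linarith [Nat.cast_nonneg (α := ℝ) j]
  exact h2 (2 * D + 1) (polyFun_mono (by omega) h1)

end Liouville

end CayleyHarmonic

namespace CayleyHarmonic

open MvPolynomial

/-! ### Polynomials of bounded degree and their dimension. -/

section LowDegree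

variable {m : ℕ}

/-- The polynomials of degree less than `n`. -/
noncomputable def lowDegree (m n : ℕ) : Submodule ℝ (MvPolynomial (Fin m) ℝ) :=
  restrictSupport ℝ {b | b.degree < n}

theorem mem_lowDegree {n : ℕ} {f : MvPolynomial (Fin m) ℝ} :
    f ∈ lowDegree m n ↔ ∀ b : Fin m →₀ ℕ, n ≤ b.degree → coeff b f = 0 := by
  rw [lowDegree, mem_restrictSupport_iff]
  constructor
  · intro h b hb
    by_contra hc
    exact absurd (h (mem_support_iff.2 hc)) (not_lt.2 hb)
  · intro h b hb
    by_contra hc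
    exact mem_support_iff.1 hb (h b (not_lt.1 hc))

theorem lowDegree_mono : Monotone (lowDegree m) := fun _ _ h _ hf =>
  mem_lowDegree.2 fun b hb => mem_lowDegree.1 hf b (h.trans hb)

theorem lowDegree_zero : lowDegree m 0 = ⊥ := by
  rw [eq_bot_iff]
  intro f hf
  rw [Submodule.mem_bot]
  ext b
  simpa using mem_lowDegree.1 hf b (Nat.zero_le _)

theorem restrictTotalDegree_eq_lowDegree (k : ℕ) :
    restrictTotalDegree (Fin m) ℝ k = lowDegree m (k + 1) := by
  rw [restrictTotalDegree, lowDegree]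
  congr 1
  ext b
  simp [Finsupp.degree_apply, Finsupp.sum]

theorem monomial_mem_lowDegree {n : ℕ} {b : Fin m →₀ ℕ} (h : b.degree < n) (a : ℝ) :
    monomial b a ∈ lowDegree m n :=
  (monomial_mem_restrictSupport ℝ).2 (Or.inl h)

theorem pderiv_mem_lowDegree {n : ℕ} {f : MvPolynomial (Fin m) ℝ} (hf : f ∈ lowDegree m n)
    (i : Fin m) : pderiv i f ∈ lowDegree m (n - 1) := by
  rw [mem_lowDegree] at hf ⊢
  intro b hb
  rw [coeff_pderiv, hf _ (by simp; omega), zero_mul]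

theorem X_mul_mem_lowDegree {n : ℕ} {f : MvPolynomial (Fin m) ℝ} (hf : f ∈ lowDegree m n)
    (i : Fin m) : X i * f ∈ lowDegree m (n + 1) := by
  rw [mem_lowDegree] at hf ⊢
  intro b hb
  rw [coeff_X_mul']
  split_ifs with h
  · apply hf
    have h1 : Finsupp.single i 1 ≤ b := by
      simpa [Nat.one_le_iff_ne_zero] using Finsupp.mem_support_iff.1 h
    have h2 := congrArg Finsupp.degree (tsub_add_cancel_of_le h1)
    rw [map_add, Finsupp.degree_single] at h2
    omega
  · rfl

/-- Induction principle for polynomials of degree less than `n`: a linear condition holds for them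
if it holds for monomials. -/
theorem lowDegree_le {n : ℕ} {V : Submodule ℝ (MvPolynomial (Fin m) ℝ)}
    (h : ∀ b : Fin m →₀ ℕ, b.degree < n → monomial b 1 ∈ V) : lowDegree m n ≤ V := by
  rw [lowDegree, restrictSupport_eq_span, Submodule.span_le]
  rintro _ ⟨b, hb, rfl⟩
  exact h b hb

/-- The exponents of degree less than `n`. -/
noncomputable def simplex (m n : ℕ) : Finset (Fin m →₀ ℕ) :=
  (Finset.range n).biUnion fun j => Finset.finsuppAntidiag Finset.univ j

theorem mem_simplex {n : ℕ} {b : Fin m →₀ ℕ} : b ∈ simplex m n ↔ b.degree < n := by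
  simp [simplex, Finset.mem_finsuppAntidiag, Finsupp.degree_eq_sum]

theorem card_simplex_succ (n : ℕ) :
    (simplex m (n + 1)).card = (m + n - 1).choose n + (simplex m n).card := by
  rw [simplex, Finset.range_add_one, Finset.biUnion_insert, Finset.card_union_of_disjoint,
    Finset.card_finsuppAntidiag_nat_eq_choose, Finset.card_univ, Fintype.card_fin, ← simplex]
  rw [← simplex, Finset.disjoint_left]
  intro b hb hb'
  rw [mem_simplex, Finsupp.degree_eq_sum] at hb'
  have hb1 : ∑ i, b i = n := (Finset.mem_finsuppAntidiag.1 hb).1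
  omega

instance (n : ℕ) : FiniteDimensional ℝ (lowDegree m n) :=
  have : Finite {b : Fin m →₀ ℕ | b.degree < n} := (Finsupp.finite_of_degree_lt n).to_subtype
  Module.Finite.of_basis (basisRestrictSupport ℝ {b : Fin m →₀ ℕ | b.degree < n})

theorem finrank_lowDegree (n : ℕ) :
    Module.finrank ℝ (lowDegree m n) = (simplex m n).card := by
  have h : {b : Fin m →₀ ℕ | b.degree < n} = ((simplex m n : Finset _) : Set _) := by
    ext b
    simp [mem_simplex]
  rw [lowDegree, h, Module.finrank_eq_card_basis (basisRestrictSupport ℝ _)]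
  simp

end LowDegree

/-! ### Taylor expansion of translations to second order. -/

section Taylor

variable {m : ℕ}

/-- The substitution `x ↦ x + c`. -/
noncomputable def shift (c : Fin m → ℝ) : MvPolynomial (Fin m) ℝ →ₐ[ℝ] MvPolynomial (Fin m) ℝ :=
  aeval fun i => X i + C (c i)

/-- The directional derivative. -/
noncomputable def dirDeriv (c : Fin m → ℝ) :
    Derivation ℝ (MvPolynomial (Fin m) ℝ) (MvPolynomial (Fin m) ℝ) :=
  ∑ j, c j • pderiv j

theorem dirDeriv_apply (c : Fin m → ℝ) (f : MvPolynomial (Fin m) ℝ) :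
    dirDeriv c f = ∑ j, c j • pderiv j f := by
  rw [dirDeriv, ← Derivation.coeFnAddMonoidHom_apply, map_sum, Finset.sum_apply]
  rfl

theorem dirDeriv_X (c : Fin m → ℝ) (i : Fin m) : dirDeriv c (X i) = C (c i) := by
  rw [dirDeriv_apply, Finset.sum_eq_single i]
  · simp [smul_eq_C_mul]
  · intro j _ hj
    rw [pderiv_X_of_ne hj.symm, smul_zero]
  · simp

theorem dirDeriv_mem_lowDegree (c : Fin m → ℝ) {n : ℕ} {f : MvPolynomial (Fin m) ℝ}
    (hf : f ∈ lowDegree m n) : dirDeriv c f ∈ lowDegree m (n - 1) := by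
  rw [dirDeriv_apply]
  exact Submodule.sum_mem _ fun j _ => Submodule.smul_mem _ _ (pderiv_mem_lowDegree hf j)

/-- The remainder of the second order Taylor expansion. -/
noncomputable def taylorRem (c : Fin m → ℝ) :
    MvPolynomial (Fin m) ℝ →ₗ[ℝ] MvPolynomial (Fin m) ℝ :=
  (shift c).toLinearMap - LinearMap.id - (dirDeriv c).toLinearMap -
    (2⁻¹ : ℝ) • ((dirDeriv c).toLinearMap ∘ₗ (dirDeriv c).toLinearMap)

theorem taylorRem_apply (c : Fin m → ℝ) (f : MvPolynomial (Fin m) ℝ) :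
    taylorRem c f = shift c f - f - dirDeriv c f - (2⁻¹ : ℝ) • dirDeriv c (dirDeriv c f) := rfl

theorem taylorRem_X_mul (c : Fin m → ℝ) (i : Fin m) (f : MvPolynomial (Fin m) ℝ) :
    taylorRem c (X i * f) =
      X i * taylorRem c f + c i • taylorRem c f +
        (2⁻¹ * c i) • dirDeriv c (dirDeriv c f) := by
  have h1 : shift c (X i) = X i + C (c i) := by simp [shift]
  simp only [taylorRem_apply, map_mul, h1, Derivation.leibniz, map_add, dirDeriv_X, smul_eq_mul,
    smul_eq_C_mul, derivation_C, mul_zero, zero_add]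
  have h2 : (C (2⁻¹ : ℝ) : MvPolynomial (Fin m) ℝ) * 2 = 1 := by
    have : (2 : MvPolynomial (Fin m) ℝ) = C 2 := (map_ofNat C 2).symm
    rw [this, ← C_mul]
    simp
  linear_combination (-(C (c i)) * dirDeriv c f) * h2

/-- Induction on monomials through `taylorRem_X_mul`: multiplying by a variable commutes with the
remainder up to terms of admissible degree. -/
theorem taylorRem_mem_lowDegree (c : Fin m → ℝ) {n : ℕ} {f : MvPolynomial (Fin m) ℝ}
    (hf : f ∈ lowDegree m n) : taylorRem c f ∈ lowDegree m (n - 3) := by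
  have key : ∀ b : Fin m →₀ ℕ, taylorRem c (monomial b 1) ∈ lowDegree m (b.degree + 1 - 3) := by
    intro b
    induction hn : b.degree generalizing b with
    | zero =>
      have hb : b = 0 := (Finsupp.degree_eq_zero_iff b).1 hn
      have : taylorRem c (monomial b 1) = 0 := by
        simp [hb, taylorRem_apply]
      rw [this]
      exact Submodule.zero_mem _
    | succ n ih =>
      obtain ⟨i, hi⟩ : ∃ i, b i ≠ 0 := by
        by_contra! h
        have : b = 0 := Finsupp.ext h
        simp [this] at hn
      have h1 : Finsupp.single i 1 ≤ b := by simpa [Nat.one_le_iff_ne_zero] using hi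
      obtain ⟨a, rfl⟩ := exists_add_of_le h1
      rw [map_add, Finsupp.degree_single] at hn
      have ha : a.degree = n := by omega
      have h2 : (monomial (Finsupp.single i 1 + a) (1 : ℝ) : MvPolynomial (Fin m) ℝ) =
          X i * monomial a 1 := by
        rw [X, monomial_mul, one_mul]
      have h3 := ih a ha
      rw [h2, taylorRem_X_mul]
      -- With truncated subtraction, `n + 1 < 3` means that the remainder itself vanishes, and so
      -- does its product with `X i`.
      have h4 : X i * taylorRem c (monomial a 1) ∈ lowDegree m (n + 1 + 1 - 3) := by
        by_cases hn3 : n + 1 < 3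
        · have : n + 1 - 3 = 0 := by omega
          rw [this, lowDegree_zero, Submodule.mem_bot] at h3
          rw [h3, mul_zero]
          exact Submodule.zero_mem _
        · exact lowDegree_mono (by omega) (X_mul_mem_lowDegree h3 i)
      refine add_mem (add_mem h4 (Submodule.smul_mem _ _ (lowDegree_mono (by omega) h3)))
        (Submodule.smul_mem _ _ ?_)
      have h5 : (monomial a (1 : ℝ)) ∈ lowDegree m (n + 1) :=
        monomial_mem_lowDegree (by omega) 1
      exact lowDegree_mono (by omega) (dirDeriv_mem_lowDegree c (dirDeriv_mem_lowDegree c h5))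
  have h : lowDegree m n ≤ (lowDegree m (n - 3)).comap (taylorRem c) :=
    lowDegree_le fun b hb => lowDegree_mono (by omega) (key b)
  exact h hf

theorem shift_sub_mem_lowDegree (c : Fin m → ℝ) {n : ℕ} {f : MvPolynomial (Fin m) ℝ}
    (hf : f ∈ lowDegree m n) : shift c f - f ∈ lowDegree m (n - 1) := by
  have h : shift c f - f =
      taylorRem c f + dirDeriv c f + (2⁻¹ : ℝ) • dirDeriv c (dirDeriv c f) := by
    rw [taylorRem_apply]
    abel
  rw [h]
  have h1 := dirDeriv_mem_lowDegree c hf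
  exact add_mem (add_mem (lowDegree_mono (by omega) (taylorRem_mem_lowDegree c hf)) h1)
    (Submodule.smul_mem _ _ (lowDegree_mono (by omega) (dirDeriv_mem_lowDegree c h1)))

end Taylor

/-! ### Surjectivity and kernels of second-order operators. -/

section Elliptic

/-- The second order differential operator with coefficients `Q`. -/
noncomputable def secondOrder {m : ℕ} (Q : Fin m → Fin m → ℝ) :
    MvPolynomial (Fin m) ℝ →ₗ[ℝ] MvPolynomial (Fin m) ℝ :=
  ∑ j, ∑ k, Q j k • ((pderiv j).toLinearMap ∘ₗ (pderiv k).toLinearMap)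

theorem secondOrder_apply {m : ℕ} (Q : Fin m → Fin m → ℝ) (f : MvPolynomial (Fin m) ℝ) :
    secondOrder Q f = ∑ j, ∑ k, Q j k • pderiv j (pderiv k f) := by
  simp [secondOrder, LinearMap.sum_apply]

theorem secondOrder_mem_lowDegree {m : ℕ} (Q : Fin m → Fin m → ℝ) {n : ℕ}
    {f : MvPolynomial (Fin m) ℝ} (hf : f ∈ lowDegree m n) :
    secondOrder Q f ∈ lowDegree m (n - 2) := by
  rw [secondOrder_apply]
  exact Submodule.sum_mem _ fun j _ => Submodule.sum_mem _ fun k _ => Submodule.smul_mem _ _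
    (pderiv_mem_lowDegree (pderiv_mem_lowDegree hf k) j)

/-- `T` agrees with the operator `secondOrder Q` up to terms of lower order. -/
def HasPrincipalPart {m : ℕ} (T : MvPolynomial (Fin m) ℝ →ₗ[ℝ] MvPolynomial (Fin m) ℝ)
    (Q : Fin m → Fin m → ℝ) : Prop :=
  ∀ n, ∀ f ∈ lowDegree m n, T f - secondOrder Q f ∈ lowDegree m (n - 3)

variable {m : ℕ} {T : MvPolynomial (Fin m) ℝ →ₗ[ℝ] MvPolynomial (Fin m) ℝ}
  {Q : Fin m → Fin m → ℝ}

theorem HasPrincipalPart.mem_lowDegree (hT : HasPrincipalPart T Q) {n : ℕ}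
    {f : MvPolynomial (Fin m) ℝ} (hf : f ∈ lowDegree m n) : T f ∈ lowDegree m (n - 2) := by
  have h := add_mem (lowDegree_mono (by omega) (hT n f hf)) (secondOrder_mem_lowDegree Q hf)
  rwa [sub_add_cancel] at h

/-- An operator whose principal part has a nonzero pure second derivative maps the polynomials of
degree at most `n + 2` onto those of degree at most `n`. -/
theorem HasPrincipalPart.lowDegree_le_map (hT : HasPrincipalPart T Q) {i : Fin m}
    (hQ : Q i i ≠ 0) (n : ℕ) : lowDegree m n ≤ (lowDegree m (n + 2)).map T := by
  induction n with
  | zero => rw [lowDegree_zero]; exact bot_le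
  | succ n ih =>
    have ih' : lowDegree m n ≤ (lowDegree m (n + 1 + 2)).map T :=
      ih.trans (Submodule.map_mono (lowDegree_mono (by omega)))
    -- Downward induction on the exponent `b i`, with `j` bounding `n - b i`.
    have key : ∀ j, ∀ b : Fin m →₀ ℕ, b.degree = n → n ≤ b i + j →
        monomial b 1 ∈ (lowDegree m (n + 1 + 2)).map T := by
      intro j
      induction j using Nat.strong_induction_on with
      | _ j ihj =>
      intro b hb hbj
      have hlarge : ∀ a : Fin m →₀ ℕ, a.degree = n → b i < a i → ∀ c : ℝ,
          monomial a c ∈ (lowDegree m (n + 1 + 2)).map T := by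
        intro a ha hab c
        have hai : a i ≤ n := ha ▸ Finsupp.le_degree i a
        have h := ihj (n - a i) (by omega) a ha (by omega)
        have h2 := Submodule.smul_mem _ c h
        rwa [smul_monomial, smul_eq_mul, mul_one] at h2
      -- The pure derivative in direction `i` returns a nonzero multiple of the monomial `b`; every
      -- other second derivative keeps an exponent above `b i` at `i`, covered by `hlarge`.
      set g : Fin m →₀ ℕ := b + Finsupp.single i 2 with hg
      have hgdeg : g.degree = n + 2 := by rw [hg, map_add, Finsupp.degree_single, hb]
      have hgmem : monomial g (1 : ℝ) ∈ lowDegree m (n + 1 + 2) :=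
        monomial_mem_lowDegree (by omega) 1
      have hrem := ih' (by simpa using hT _ _ hgmem)
      have hTg : T (monomial g 1) ∈ (lowDegree m (n + 1 + 2)).map T :=
        Submodule.mem_map_of_mem hgmem
      have hsec := sub_mem hTg hrem
      rw [sub_sub_cancel, secondOrder_apply] at hsec
      have hterm : ∀ k l, ¬(k = i ∧ l = i) →
          Q k l • pderiv k (pderiv l (monomial g (1 : ℝ))) ∈
            (lowDegree m (n + 1 + 2)).map T := by
        intro k l hkl
        refine Submodule.smul_mem _ _ ?_
        rw [pderiv_monomial, pderiv_monomial]
        by_cases hl : g l = 0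
        · simp [hl]
        by_cases hk : (g - Finsupp.single l 1 : Fin m →₀ ℕ) k = 0
        · rw [hk]
          simp
        have hl1 : Finsupp.single l 1 ≤ g := by simpa [Nat.one_le_iff_ne_zero] using hl
        have hk1 : Finsupp.single k 1 ≤ g - Finsupp.single l 1 := by
          simpa only [Finsupp.single_le_iff, Nat.one_le_iff_ne_zero] using hk
        have hd1 := congrArg Finsupp.degree (tsub_add_cancel_of_le hl1)
        have hd2 := congrArg Finsupp.degree (tsub_add_cancel_of_le hk1)
        rw [map_add, Finsupp.degree_single] at hd1 hd2
        refine hlarge _ (by omega) ?_ _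
        have hgi : g i = b i + 2 := by simp [hg]
        simp only [Finsupp.tsub_apply, hgi]
        rcases eq_or_ne k i with rfl | hki
        · have hli : l ≠ k := fun h => hkl ⟨rfl, h⟩
          simp [hli]
        · simp only [Finsupp.single_apply, hki, if_false]
          split_ifs <;> omega
      rw [← Finset.add_sum_erase _ _ (Finset.mem_univ i)] at hsec
      rw [← Finset.add_sum_erase _ _ (Finset.mem_univ i)] at hsec
      have hrest := add_mem
        (Submodule.sum_mem _ fun l (hl : l ∈ Finset.univ.erase i) =>
          hterm i l fun h => Finset.ne_of_mem_erase hl h.2)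
        (Submodule.sum_mem _ fun k (hk : k ∈ Finset.univ.erase i) =>
          Submodule.sum_mem _ fun l (_ : l ∈ Finset.univ) =>
            hterm k l fun h => Finset.ne_of_mem_erase hk h.1)
      have hmain := sub_mem hsec hrest
      rw [add_assoc (Q i i • _), add_sub_cancel_right] at hmain
      have hdd : pderiv i (pderiv i (monomial g (1 : ℝ))) =
          (((b i : ℝ) + 2) * ((b i : ℝ) + 1)) • monomial b (1 : ℝ) := by
        rw [pderiv_monomial, pderiv_monomial, smul_monomial]
        have h1 : g - Finsupp.single i 1 - Finsupp.single i 1 = b := by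
          ext k
          rcases eq_or_ne i k with rfl | hk
          · simp [hg]
          · simp [hg, hk]
        rw [h1]
        congr 1
        simp [hg]
      rw [hdd, smul_smul] at hmain
      have hne : Q i i * (((b i : ℝ) + 2) * ((b i : ℝ) + 1)) ≠ 0 :=
        mul_ne_zero hQ (by positivity)
      exact (Submodule.smul_mem_iff _ hne).1 hmain
    refine lowDegree_le fun b hb => ?_
    rcases Nat.lt_succ_iff_lt_or_eq.1 hb with hb | hb
    · exact ih' (monomial_mem_lowDegree hb 1)
    · exact key n b hb (Nat.le_add_left _ _)

/-- Rank-nullity for `T` from degree `< n` onto degree `< n - 2`; for `n < 2` the truncated target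
is zero. -/
theorem HasPrincipalPart.finrank_ker_add (hT : HasPrincipalPart T Q) {i : Fin m}
    (hQ : Q i i ≠ 0) (n : ℕ) :
    Module.finrank ℝ ((lowDegree m n ⊓ LinearMap.ker T : Submodule ℝ _)) +
      (simplex m (n - 2)).card = (simplex m n).card := by
  have hmap : (lowDegree m n).map T = lowDegree m (n - 2) := by
    refine le_antisymm ?_ ?_
    · rintro _ ⟨f, hf, rfl⟩
      exact hT.mem_lowDegree hf
    · rcases Nat.lt_or_ge n 2 with h | h
      · have : n - 2 = 0 := by omega
        rw [this, lowDegree_zero]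
        exact bot_le
      · have := hT.lowDegree_le_map hQ (n - 2)
        rwa [Nat.sub_add_cancel h] at this
  have h := LinearMap.finrank_range_add_finrank_ker (T.domRestrict (lowDegree m n))
  have hker : Module.finrank ℝ (LinearMap.ker (T.domRestrict (lowDegree m n))) =
      Module.finrank ℝ ((lowDegree m n ⊓ LinearMap.ker T : Submodule ℝ _)) := by
    rw [LinearMap.ker_domRestrict, ← Submodule.map_comap_subtype]
    exact (Submodule.equivMapOfInjective _ (Submodule.injective_subtype _) _).finrank_eq
  rw [hker, LinearMap.range_domRestrict, hmap, finrank_lowDegree, finrank_lowDegree] at h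
  omega

/-- In no variables every such operator vanishes. -/
theorem HasPrincipalPart.lowDegree_inf_ker_of_zero
    {T : MvPolynomial (Fin 0) ℝ →ₗ[ℝ] MvPolynomial (Fin 0) ℝ} {Q : Fin 0 → Fin 0 → ℝ}
    (hT : HasPrincipalPart T Q) (n : ℕ) : lowDegree 0 n ⊓ LinearMap.ker T = lowDegree 0 n := by
  refine inf_eq_left.2 fun f _ => ?_
  have h1 : f ∈ lowDegree 0 1 := by
    rw [CayleyHarmonic.mem_lowDegree]
    intro b hb
    simp [Subsingleton.elim b 0] at hb
  have h2 := hT.mem_lowDegree h1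
  rw [LinearMap.mem_ker]
  simpa [lowDegree_zero] using h2

theorem polyLaplacian_hasPrincipalPart (m : ℕ) :
    HasPrincipalPart (polyLaplacian m) fun i j => if i = j then 1 else 0 := by
  intro n f _
  have : polyLaplacian m f - secondOrder (fun i j => if i = j then 1 else 0) f = 0 := by
    simp [polyLaplacian, secondOrder_apply, LinearMap.sum_apply]
  rw [this]
  exact Submodule.zero_mem _

end Elliptic

end CayleyHarmonic

namespace CayleyHarmonic

open MvPolynomial

/-! ### Polynomial functions as polynomials in the free coordinates. -/

section Lattice

variable {G : Type*} [AddCommGroup G] {m : ℕ} (π : G →+ (Fin m → ℤ))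

/-- The real coordinates of the free part of an element. -/
def realCoord (x : G) : Fin m → ℝ := fun i => (π x i : ℝ)

theorem realCoord_add (x y : G) : realCoord π (x + y) = realCoord π x + realCoord π y := by
  funext i
  simp [realCoord]

theorem realCoord_neg (x : G) : realCoord π (-x) = -realCoord π x := by
  funext i
  simp [realCoord]

/-- The function on `G` defined by a polynomial in the coordinates of the free part. -/
noncomputable def evalLattice : MvPolynomial (Fin m) ℝ →ₗ[ℝ] (G → ℝ) where
  toFun f := fun x => eval (realCoord π x) f
  map_add' f g := by
    funext x
    simp
  map_smul' c f := by
    funext x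
    simp [smul_eval]

theorem evalLattice_apply (f : MvPolynomial (Fin m) ℝ) (x : G) :
    evalLattice π f x = eval (realCoord π x) f := rfl

theorem evalLattice_shift (g : G) (f : MvPolynomial (Fin m) ℝ) (x : G) :
    evalLattice π (shift (realCoord π g) f) x = evalLattice π f (x + g) := by
  rw [evalLattice_apply, evalLattice_apply, shift, ← coe_aeval_eq_eval, ← coe_aeval_eq_eval,
    RingHom.coe_coe, RingHom.coe_coe, ← AlgHom.comp_apply, comp_aeval, realCoord_add]
  congr 2
  funext i
  simp

theorem diff_evalLattice (g : G) (f : MvPolynomial (Fin m) ℝ) :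
    diff g (evalLattice π f) = evalLattice π (shift (realCoord π g) f - f) := by
  funext x
  rw [map_sub, Pi.sub_apply, evalLattice_shift, diff_apply]

theorem evalLattice_mem_polyFun {n : ℕ} {f : MvPolynomial (Fin m) ℝ} (hf : f ∈ lowDegree m n) :
    evalLattice π f ∈ polyFun G n := by
  induction n generalizing f with
  | zero =>
    rw [lowDegree_zero, Submodule.mem_bot] at hf
    rw [hf, map_zero]
    exact Submodule.zero_mem _
  | succ n ih =>
    rw [mem_polyFun_succ]
    intro g
    rw [diff_evalLattice]
    exact ih (shift_sub_mem_lowDegree _ hf)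

variable {π}

theorem evalLattice_injective (hπ : Function.Surjective π) :
    Function.Injective (evalLattice π) := by
  intro f g hfg
  refine funext_set (fun _ => Set.range ((↑) : ℤ → ℝ))
    (fun _ => Set.infinite_range_of_injective Int.cast_injective) fun x hx => ?_
  choose y hy using fun i => hx i (Set.mem_univ i)
  obtain ⟨z, hz⟩ := hπ y
  have hzx : realCoord π z = x := by
    funext i
    rw [realCoord, hz, hy]
  have := congrFun hfg z
  rwa [evalLattice_apply, evalLattice_apply, hzx] at this

/-- Every element is an integral combination of lifts of the standard basis vectors, up to the
kernel of the projection. -/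
theorem map_sub_sum_eq_zero {e : Fin m → G} (he : ∀ i, π (e i) = Pi.single i 1) (x : G) :
    π (x - ∑ i, π x i • e i) = 0 := by
  rw [map_sub, map_sum, sub_eq_zero]
  funext j
  simp [he, Finset.sum_apply, Pi.single_apply]

theorem exists_lift (hπ : Function.Surjective π) :
    ∃ e : Fin m → G, ∀ i, π (e i) = Pi.single i 1 :=
  ⟨fun i => (hπ (Pi.single i 1)).choose, fun i => (hπ (Pi.single i 1)).choose_spec⟩

theorem isOfFinAddOrder_of_map_eq_zero (hker : {x | π x = 0}.Finite) {t : G} (ht : π t = 0) :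
    IsOfFinAddOrder t := by
  refine finite_zmultiples.1 (hker.subset ?_)
  rintro _ ⟨k, rfl⟩
  simp [ht]

/-- Differences along the `e i` vanish on the next smaller simplex, hence identically by induction.
Torsion differences vanish as well, so `u` is constant, with value zero at the origin. -/
theorem eq_zero_of_mem_polyFun (hker : {x | π x = 0}.Finite) {e : Fin m → G}
    (he : ∀ i, π (e i) = Pi.single i 1) {n : ℕ} {u : G → ℝ} (hu : u ∈ polyFun G n)
    (h : ∀ b ∈ simplex m n, u (∑ i, b i • e i) = 0) : u = 0 := by
  induction n generalizing u with
  | zero => exact mem_polyFun_zero.1 hu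
  | succ n ih =>
    have h1 : ∀ i, diff (e i) u = 0 := by
      intro i
      refine ih (mem_polyFun_succ.1 hu _) fun b hb => ?_
      rw [mem_simplex] at hb
      have h2 : ∑ j, (b + Finsupp.single i 1 : Fin m →₀ ℕ) j • e j = ∑ j, b j • e j + e i := by
        simp only [Finsupp.add_apply, add_smul, Finset.sum_add_distrib]
        congr 1
        rw [Finset.sum_eq_single i (fun j _ hj => by simp [hj.symm]) (by simp)]
        simp
      rw [diff_apply, ← h2, h _ (mem_simplex.2 (by rw [map_add, Finsupp.degree_single]; omega)),
        h b (mem_simplex.2 (by omega)), sub_zero]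
    have h2 : ∀ x, x ∈ diffStabilizer u 0 := by
      intro x
      rw [← sub_add_cancel x (∑ i, π x i • e i)]
      refine add_mem ?_ (sum_mem fun i _ => (diffStabilizer u 0).zsmul_mem ?_ _)
      swap
      · exact mem_polyFun_zero.2 (h1 i)
      exact mem_polyFun_zero.2 (diff_eq_zero_of_isOfFinAddOrder
        (isOfFinAddOrder_of_map_eq_zero hker (map_sub_sum_eq_zero he x)) hu)
    have h3 : u ∈ polyFun G 1 := mem_polyFun_succ.2 h2
    funext x
    have h4 := h 0 (mem_simplex.2 (by simp))
    rw [mem_polyFun_one.1 h3 x]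
    simpa using h4

/-- The polynomial functions of degree less than `n` on `G` are those given by polynomials in the
coordinates of the free part. -/
theorem map_evalLattice (hπ : Function.Surjective π) (hker : {x | π x = 0}.Finite) (n : ℕ) :
    (lowDegree m n).map (evalLattice π) = polyFun G n := by
  obtain ⟨e, he⟩ := exists_lift hπ
  -- Restriction to the simplex is injective, so the dimension is at most that of the polynomials;
  -- the easy inclusion is then an equality.
  let restr : polyFun G n →ₗ[ℝ] (simplex m n → ℝ) :=
    (LinearMap.funLeft ℝ ℝ fun b : simplex m n => ∑ i, (b : Fin m →₀ ℕ) i • e i) ∘ₗ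
      (polyFun G n).subtype
  have hinj : Function.Injective restr := by
    rw [← LinearMap.ker_eq_bot, LinearMap.ker_eq_bot']
    intro u hu
    exact Subtype.ext (eq_zero_of_mem_polyFun hker he u.2 fun b hb => congrFun hu ⟨b, hb⟩)
  have : FiniteDimensional ℝ (polyFun G n) := FiniteDimensional.of_injective restr hinj
  refine Submodule.eq_of_le_of_finrank_le ?_ ?_
  · rintro _ ⟨f, hf, rfl⟩
    exact evalLattice_mem_polyFun π hf
  · refine (LinearMap.finrank_le_finrank_of_injective hinj).trans (le_of_eq ?_)
    rw [← (Submodule.equivMapOfInjective _ (evalLattice_injective hπ) _).finrank_eq,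
      finrank_lowDegree]
    simp

/-- The squared word metric is dominated by a quadratic polynomial function. -/
theorem exists_sq_wordDist_le {S : Multiset G} (hgen : IsSymmGenerating S)
    (hπ : Function.Surjective π) (hker : {x | π x = 0}.Finite) (p : G) :
    ∃ w ∈ polyFun G 3, ∀ x, ((wordDist S p x : ℝ) + 1) ^ 2 ≤ w x := by
  obtain ⟨e, he⟩ := exists_lift hπ
  obtain ⟨B, hB⟩ : ∃ B : ℕ, ∀ t, π t = 0 → wordDist S 0 t ≤ B := by
    obtain ⟨B, hB⟩ := (hker.image (wordDist S 0)).bddAbove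
    exact ⟨B, fun t ht => hB ⟨t, ht, rfl⟩⟩
  set c : G → Fin m → ℝ := fun x i => realCoord π (x - p) i with hc
  set Y : ℝ := ∑ i, (wordDist S 0 (e i) : ℝ) ^ 2 with hY
  have hY0 : 0 ≤ Y := Finset.sum_nonneg fun i _ => sq_nonneg _
  -- The constant comes from `((B + 1) + Z)² ≤ 2 (B + 1)² + 2 Z²` and Cauchy–Schwarz for `Z`.
  refine ⟨(2 * (Y + ((B : ℝ) + 1) ^ 2)) • ((fun _ => 1) + ∑ i, (fun x => c x i) ^ 2), ?_, ?_⟩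
  · refine Submodule.smul_mem _ _ (add_mem (const_mem_polyFun 1 2)
      (Submodule.sum_mem _ fun i _ => ?_))
    have : (fun x => c x i) ∈ polyFun G (1 + 1) := by
      rw [mem_polyFun_succ]
      intro g
      have : diff g (fun x => c x i) = fun _ => realCoord π g i := by
        funext x
        simp [hc, realCoord]
      rw [this]
      exact const_mem_polyFun _ 0
    simpa using pow_mem_polyFun this 2
  · intro x
    have h1 : wordDist S p x ≤ B + ∑ i, (π (x - p) i).natAbs * wordDist S 0 (e i) := by
      rw [wordDist_eq_zero_sub]
      conv_lhs => rw [← sub_add_cancel (x - p) (∑ i, π (x - p) i • e i)]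
      refine (wordDist_zero_add_le hgen _ _).trans (Nat.add_le_add
        (hB _ (map_sub_sum_eq_zero he _)) ((wordDist_zero_sum_le hgen _ _).trans ?_))
      exact Finset.sum_le_sum fun i _ => wordDist_zero_zsmul_le hgen _ _
    set Z : ℝ := ∑ i, ((π (x - p) i).natAbs : ℝ) * (wordDist S 0 (e i) : ℝ) with hZ
    have h2 : (wordDist S p x : ℝ) + 1 ≤ (B + 1) + Z := by
      have : (wordDist S p x : ℝ) ≤ B + Z := by
        rw [hZ]
        exact_mod_cast h1
      linarith
    have h3 : Z ^ 2 ≤ (∑ i, c x i ^ 2) * Y := by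
      have := Finset.sum_mul_sq_le_sq_mul_sq Finset.univ
        (fun i => ((π (x - p) i).natAbs : ℝ)) (fun i => (wordDist S 0 (e i) : ℝ))
      have h4 : ∀ i, ((π (x - p) i).natAbs : ℝ) ^ 2 = c x i ^ 2 := by
        intro i
        rw [Nat.cast_natAbs, Int.cast_abs, sq_abs]
        rfl
      simpa only [h4] using this
    have hX0 : 0 ≤ ∑ i, c x i ^ 2 := Finset.sum_nonneg fun i _ => sq_nonneg _
    have h5 : ((wordDist S p x : ℝ) + 1) ^ 2 ≤ ((B + 1) + Z) ^ 2 :=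
      pow_le_pow_left₀ (by positivity) h2 2
    simp only [Pi.smul_apply, Pi.add_apply, Finset.sum_apply, Pi.pow_apply, smul_eq_mul]
    have h6 := mul_nonneg hX0 (sq_nonneg ((B : ℝ) + 1))
    nlinarith [sq_nonneg ((B : ℝ) + 1 - Z)]

variable {ι : Type*} [Fintype ι] {S : Multiset G} {s : ι → G}

theorem laplacian_apply (hS : S = Finset.univ.val.map s) (u : G → ℝ) (x : G) :
    laplacian S u x = ∑ i, (u (x + s i) - u x) := by
  subst hS
  simp only [laplacian, LinearMap.coe_mk, AddHom.coe_mk, Multiset.map_map]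
  rfl

theorem avg_eq_self_of_laplacian_eq_zero [Nonempty ι] (hS : S = Finset.univ.val.map s)
    {u : G → ℝ} (hu : laplacian S u = 0) : avg s u = u := by
  funext x
  have hc : (Fintype.card ι : ℝ) ≠ 0 := Nat.cast_ne_zero.2 Fintype.card_ne_zero
  have h := congrFun hu x
  rw [laplacian_apply hS, Finset.sum_sub_distrib, Pi.zero_apply, sub_eq_zero, Finset.sum_const,
    Finset.card_univ, nsmul_eq_mul] at h
  rw [avg_apply, h, mul_div_cancel_left₀ _ hc]

/-- The Liouville theorem: harmonic functions bounded below by a power `d` of the distance are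
polynomial functions of degree at most `d`. -/
theorem mem_polyFun_of_laplacian_eq_zero (hS : S = Finset.univ.val.map s)
    (hgen : IsSymmGenerating S) (hπ : Function.Surjective π) (hker : {x | π x = 0}.Finite) (p : G)
    {d : ℝ} (hd : 0 ≤ d) {u : G → ℝ} (hu : laplacian S u = 0) {C : ℝ}
    (hC : ∀ x, u x ≥ -C * ((wordDist S p x : ℝ) + 1) ^ d) : u ∈ polyFun G (⌊d⌋₊ + 1) := by
  rcases isEmpty_or_nonempty ι with hι | hι
  -- Without steps the group is trivial and averaging would divide by zero; there are no generators
  -- to test.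
  · exact mem_polyFun_succ_of_closure (closure_range hS hgen) (by simp)
  · obtain ⟨w, hw, hpw⟩ := exists_sq_wordDist_le hgen hπ hker p
    exact mem_polyFun_of_one_sided hS hgen p hw hpw hd
      (avg_eq_self_of_laplacian_eq_zero hS hu) hC

theorem mem_polyGrowth_iff (hS : S = Finset.univ.val.map s)
    (hgen : IsSymmGenerating S) (hπ : Function.Surjective π) (hker : {x | π x = 0}.Finite) (p : G)
    {d : ℝ} (hd : 0 ≤ d) {u : G → ℝ} :
    u ∈ polyGrowth S p d ↔ u ∈ polyFun G (⌊d⌋₊ + 1) ∧ laplacian S u = 0 := by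
  constructor
  · rintro ⟨hu, C, hC⟩
    refine ⟨mem_polyFun_of_laplacian_eq_zero (C := C) hS hgen hπ hker p hd hu fun x => ?_, hu⟩
    rw [neg_mul]
    exact (abs_le.1 (hC x)).1
  · rintro ⟨hu, h0⟩
    obtain ⟨C, hC0, hC⟩ := exists_le_of_mem_polyFun hS hgen p hu
    refine ⟨h0, C, fun x => (hC x).trans (mul_le_mul_of_nonneg_left ?_ hC0)⟩
    rw [← Real.rpow_natCast]
    refine Real.rpow_le_rpow_of_exponent_le ?_ (Nat.floor_le hd)
    linarith [Nat.cast_nonneg (α := ℝ) (wordDist S p x)]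

theorem oneSidedGrowth_eq_polyGrowth (hS : S = Finset.univ.val.map s)
    (hgen : IsSymmGenerating S) (hπ : Function.Surjective π) (hker : {x | π x = 0}.Finite) (p : G)
    {d : ℝ} (hd : 0 ≤ d) : oneSidedGrowth S p d = polyGrowth S p d := by
  rw [oneSidedGrowth]
  refine le_antisymm (Submodule.span_le.2 ?_) fun u hu => Submodule.subset_span ?_
  · rintro u ⟨hu, C, hC⟩
    exact (mem_polyGrowth_iff hS hgen hπ hker p hd).2
      ⟨mem_polyFun_of_laplacian_eq_zero hS hgen hπ hker p hd hu hC, hu⟩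
  · obtain ⟨h0, C, hC⟩ := hu
    refine ⟨h0, C, fun x => ?_⟩
    rw [neg_mul]
    exact (abs_le.1 (hC x)).1

variable (π s) in
/-- The discrete Laplacian acting on polynomials. -/
noncomputable def latticeLaplacian : MvPolynomial (Fin m) ℝ →ₗ[ℝ] MvPolynomial (Fin m) ℝ :=
  ∑ i, ((shift (realCoord π (s i))).toLinearMap - LinearMap.id)

theorem latticeLaplacian_apply (f : MvPolynomial (Fin m) ℝ) :
    latticeLaplacian π s f = ∑ i, (shift (realCoord π (s i)) f - f) := by
  simp [latticeLaplacian, LinearMap.sum_apply]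

theorem laplacian_evalLattice (hS : S = Finset.univ.val.map s) (f : MvPolynomial (Fin m) ℝ) :
    laplacian S (evalLattice π f) = evalLattice π (latticeLaplacian π s f) := by
  funext x
  rw [laplacian_apply hS, latticeLaplacian_apply, map_sum, Finset.sum_apply]
  refine Finset.sum_congr rfl fun i _ => ?_
  rw [map_sub, Pi.sub_apply, evalLattice_shift]

/-- Summing Taylor expansions over the steps, symmetry cancels the first-order terms; the factor
`2⁻¹` is the Taylor coefficient. -/
theorem latticeLaplacian_hasPrincipalPart (hS : S = Finset.univ.val.map s)
    (hgen : IsSymmGenerating S) :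
    HasPrincipalPart (latticeLaplacian π s)
      fun j k => 2⁻¹ * ∑ i, realCoord π (s i) j * realCoord π (s i) k := by
  intro n f hf
  have h1 : ∑ i, dirDeriv (realCoord π (s i)) f = 0 := by
    have h := sum_comp_neg hS hgen fun g => dirDeriv (realCoord π g) f
    have h2 : ∀ i, dirDeriv (realCoord π (-s i)) f = -dirDeriv (realCoord π (s i)) f := by
      intro i
      simp [realCoord_neg, dirDeriv_apply]
    simp only [h2, Finset.sum_neg_distrib] at h
    exact self_eq_neg.1 h
  have h2 : ∀ c : Fin m → ℝ, dirDeriv c (dirDeriv c f) =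
      ∑ j, ∑ k, (c j * c k) • pderiv j (pderiv k f) := by
    intro c
    simp only [dirDeriv_apply, map_sum, Finset.smul_sum, Derivation.map_smul, smul_smul]
    rw [Finset.sum_comm]
    simp only [mul_comm]
  have h3 : latticeLaplacian π s f -
      secondOrder (fun j k => 2⁻¹ * ∑ i, realCoord π (s i) j * realCoord π (s i) k) f =
      ∑ i, taylorRem (realCoord π (s i)) f := by
    have h4 : secondOrder (fun j k => 2⁻¹ * ∑ i, realCoord π (s i) j * realCoord π (s i) k) f =
        ∑ i, (2⁻¹ : ℝ) • dirDeriv (realCoord π (s i)) (dirDeriv (realCoord π (s i)) f) := by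
      simp only [h2, secondOrder_apply, Finset.smul_sum, Finset.mul_sum, Finset.sum_smul,
        smul_smul]
      rw [Finset.sum_comm]
      symm
      rw [Finset.sum_comm]
      simp_rw [Finset.sum_comm (s := (Finset.univ : Finset ι))]
      rw [Finset.sum_comm]
    simp only [taylorRem_apply, Finset.sum_sub_distrib, h1, sub_zero, h4, latticeLaplacian_apply]
  rw [h3]
  exact Submodule.sum_mem _ fun i _ => taylorRem_mem_lowDegree _ hf

/-- A zero sum of squares would put all generators, hence `G`, in the kernel of the `j`-th
coordinate, against surjectivity. -/
theorem principalPart_pos (hS : S = Finset.univ.val.map s) (hgen : IsSymmGenerating S)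
    (hπ : Function.Surjective π) (j : Fin m) :
    2⁻¹ * ∑ i, realCoord π (s i) j * realCoord π (s i) j ≠ 0 := by
  intro h
  have h1 : ∑ i, realCoord π (s i) j * realCoord π (s i) j = 0 := by linarith
  rw [Finset.sum_eq_zero_iff_of_nonneg fun i _ => mul_self_nonneg _] at h1
  have h2 : AddSubgroup.closure (Set.range s) ≤
      ((Pi.evalAddMonoidHom (fun _ : Fin m => ℤ) j).comp π).ker := by
    rw [AddSubgroup.closure_le]
    rintro _ ⟨i, rfl⟩
    have := mul_self_eq_zero.1 (h1 i (Finset.mem_univ i))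
    rw [realCoord, Int.cast_eq_zero] at this
    exact this
  rw [closure_range hS hgen] at h2
  obtain ⟨x, hx⟩ := hπ (Pi.single j 1)
  have h3 : π x j = 0 := h2 (AddSubgroup.mem_top x)
  simp [hx] at h3

theorem polyGrowth_eq_map (hS : S = Finset.univ.val.map s) (hgen : IsSymmGenerating S)
    (hπ : Function.Surjective π) (hker : {x | π x = 0}.Finite) (p : G) {d : ℝ} (hd : 0 ≤ d) :
    polyGrowth S p d =
      (lowDegree m (⌊d⌋₊ + 1) ⊓ LinearMap.ker (latticeLaplacian π s)).map (evalLattice π) := by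
  ext u
  rw [mem_polyGrowth_iff hS hgen hπ hker p hd, ← map_evalLattice hπ hker]
  constructor
  · rintro ⟨⟨f, hf, rfl⟩, h⟩
    rw [laplacian_evalLattice hS] at h
    exact ⟨f, ⟨hf, evalLattice_injective hπ (h.trans (map_zero _).symm)⟩, rfl⟩
  · rintro ⟨f, ⟨hf, h⟩, rfl⟩
    refine ⟨⟨f, hf, rfl⟩, ?_⟩
    rw [laplacian_evalLattice hS, LinearMap.mem_ker.1 h, map_zero]

end Lattice

/-! ### Dimension formulas and the main theorem. -/

theorem harmonicPoly_eq (m k : ℕ) :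
    harmonicPoly m k = lowDegree m (k + 1) ⊓ LinearMap.ker (polyLaplacian m) := by
  rw [harmonicPoly, restrictTotalDegree_eq_lowDegree]

instance (m k : ℕ) : FiniteDimensional ℝ (harmonicPoly m k) := by
  rw [harmonicPoly_eq]
  exact Submodule.finiteDimensional_of_le inf_le_left

theorem finrank_harmonicPoly_add (m k : ℕ) (hm : 1 ≤ m) :
    Module.finrank ℝ (harmonicPoly m k) + (simplex m (k + 1 - 2)).card =
      (simplex m (k + 1)).card := by
  rw [harmonicPoly_eq]
  exact (polyLaplacian_hasPrincipalPart m).finrank_ker_add (i := ⟨0, hm⟩) (by simp) (k + 1)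

/-- The difference of the two simplex cardinalities consists of the exponents of degree `k` and `k -
1`. -/
theorem finrank_harmonicPoly (m k : ℕ) (hm : 1 ≤ m) :
    Module.finrank ℝ (harmonicPoly m k) =
      (m + k - 1).choose k + if k = 0 then 0 else (m + k - 2).choose (k - 1) := by
  have h := finrank_harmonicPoly_add m k hm
  rw [card_simplex_succ] at h
  rcases k with _ | k
  · simpa [simplex] using h
  · have h1 : m + (k + 1) - 2 = m + k - 1 := by omega
    have h2 : k + 1 + 1 - 2 = k := by omega
    rw [card_simplex_succ, h2] at h
    rw [if_neg (Nat.succ_ne_zero k), h1, Nat.add_sub_cancel]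
    omega

theorem finrank_inf_ker_eq {m : ℕ} {T T' : MvPolynomial (Fin m) ℝ →ₗ[ℝ] MvPolynomial (Fin m) ℝ}
    {Q Q' : Fin m → Fin m → ℝ} (hT : HasPrincipalPart T Q) (hT' : HasPrincipalPart T' Q')
    (hQ : ∀ i, Q i i ≠ 0) (hQ' : ∀ i, Q' i i ≠ 0) (n : ℕ) :
    Module.finrank ℝ (lowDegree m n ⊓ LinearMap.ker T : Submodule ℝ _) =
      Module.finrank ℝ (lowDegree m n ⊓ LinearMap.ker T' : Submodule ℝ _) := by
  rcases m with _ | m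
  -- In no variables there is no direction `i` to use; both operators vanish.
  · rw [hT.lowDegree_inf_ker_of_zero, hT'.lowDegree_inf_ker_of_zero]
  · have h1 := hT.finrank_ker_add (hQ 0) n
    have h2 := hT'.finrank_ker_add (hQ' 0) n
    omega

/-- The dimension theorem for a single generating multiset. -/
theorem finrank_growth {G : Type*} [AddCommGroup G] {m : ℕ} {π : G →+ (Fin m → ℤ)}
    (hπ : Function.Surjective π) (hker : {x | π x = 0}.Finite) {S : Multiset G}
    (hgen : IsSymmGenerating S) (p : G) {d : ℝ} (hd : 0 ≤ d) :
    oneSidedGrowth S p d = polyGrowth S p d ∧ FiniteDimensional ℝ (polyGrowth S p d) ∧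
      Module.finrank ℝ (polyGrowth S p d) = Module.finrank ℝ (harmonicPoly m ⌊d⌋₊) := by
  classical
  have hS : S = Finset.univ.val.map (fun i : S.ToType => (i : G)) := S.map_univ_coe.symm
  refine ⟨oneSidedGrowth_eq_polyGrowth hS hgen hπ hker p hd, ?_, ?_⟩
  · rw [polyGrowth_eq_map hS hgen hπ hker p hd]
    have : FiniteDimensional ℝ (lowDegree m (⌊d⌋₊ + 1) ⊓
        LinearMap.ker (latticeLaplacian π fun i : S.ToType => (i : G)) : Submodule ℝ _) :=
      Submodule.finiteDimensional_of_le inf_le_left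
    infer_instance
  · rw [polyGrowth_eq_map hS hgen hπ hker p hd, harmonicPoly_eq,
      ← (Submodule.equivMapOfInjective _ (evalLattice_injective hπ) _).finrank_eq]
    exact finrank_inf_ker_eq (latticeLaplacian_hasPrincipalPart hS hgen)
      (polyLaplacian_hasPrincipalPart m) (principalPart_pos hS hgen hπ) (by simp) _

end CayleyHarmonic

theorem theorem1p4 {G : Type*} [AddCommGroup G] (m l : ℕ) (q : Fin l → ℕ) (hq : ∀ i, 1 ≤ q i)
    (hG : Nonempty (G ≃+ (Fin m → ℤ) × ((i : Fin l) → ZMod (q i)))) (d : ℝ) (hd : 0 ≤ d) :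
    (∀ (S : Multiset G) (p : G), CayleyHarmonic.IsSymmGenerating S →
      FiniteDimensional ℝ (CayleyHarmonic.oneSidedGrowth S p d) ∧
      FiniteDimensional ℝ (CayleyHarmonic.polyGrowth S p d) ∧
      FiniteDimensional ℝ (CayleyHarmonic.harmonicPoly m ⌊d⌋₊) ∧
      Module.finrank ℝ (CayleyHarmonic.oneSidedGrowth S p d) =
        Module.finrank ℝ (CayleyHarmonic.polyGrowth S p d) ∧
      Module.finrank ℝ (CayleyHarmonic.polyGrowth S p d) =
        Module.finrank ℝ (CayleyHarmonic.harmonicPoly m ⌊d⌋₊) ∧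
      (1 ≤ m → Module.finrank ℝ (CayleyHarmonic.harmonicPoly m ⌊d⌋₊) =
        (m + ⌊d⌋₊ - 1).choose ⌊d⌋₊ +
          if ⌊d⌋₊ = 0 then 0 else (m + ⌊d⌋₊ - 2).choose (⌊d⌋₊ - 1))) ∧
    (∀ (S S' : Multiset G) (p p' : G), CayleyHarmonic.IsSymmGenerating S →
      CayleyHarmonic.IsSymmGenerating S' →
      Module.finrank ℝ (CayleyHarmonic.oneSidedGrowth S p d) =
        Module.finrank ℝ (CayleyHarmonic.oneSidedGrowth S' p' d) ∧
      Module.finrank ℝ (CayleyHarmonic.polyGrowth S p d) =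
        Module.finrank ℝ (CayleyHarmonic.polyGrowth S' p' d)) := by
  obtain ⟨e⟩ := hG
  set π : G →+ (Fin m → ℤ) := (AddMonoidHom.fst _ _).comp e.toAddMonoidHom with hπdef
  have hπ : Function.Surjective π := fun y => ⟨e.symm (y, 0), by simp [hπdef]⟩
  have hker : {x | π x = 0}.Finite := by
    -- `ZMod 0` is infinite; `q i ≥ 1` makes the torsion factor, hence the kernel, finite.
    have : ∀ i, NeZero (q i) := fun i => ⟨Nat.one_le_iff_ne_zero.1 (hq i)⟩
    refine Set.Finite.of_finite_image (f := fun x => (e x).2) (Set.toFinite _) ?_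
    intro x hx y hy hxy
    refine e.injective (Prod.ext ?_ hxy)
    exact (show (e x).1 = 0 from hx).trans (show (e y).1 = 0 from hy).symm
  have key := fun (S : Multiset G) (p : G) (hS : CayleyHarmonic.IsSymmGenerating S) =>
    CayleyHarmonic.finrank_growth hπ hker hS p hd
  refine ⟨fun S p hS => ?_, fun S S' p p' hS hS' => ?_⟩
  · obtain ⟨h1, h2, h3⟩ := key S p hS
    rw [h1]
    exact ⟨h2, h2, inferInstance, rfl, h3, CayleyHarmonic.finrank_harmonicPoly m _⟩
  · obtain ⟨h1, -, h3⟩ := key S p hS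
    obtain ⟨h1', -, h3'⟩ := key S' p' hS'
    rw [h1, h1']
    exact ⟨h3.trans h3'.symm, h3.trans h3'.symm⟩
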